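/- Consider the network synchronization model with single-input single-output subsystems $$\dot x_i = A x_i + B\Big(\alpha\sum_{j\neq i} g_{ij}(y_j-y_i)+\gamma_i w_i\Big),\qquad y_i = C x_i,\qquad i=1,\dots,N,$$ where $A\in\mathbb R^{n\times n}$, $B\in\mathbb R^{n\times 1}$, $C\in\mathbb R^{1\times n}$, $g_{ij}\ge 0$, $\alpha>0$, and a disturbance $w$ acts at a single source node $s$ ($\gamma_s=1$, $\gamma_i=0$ for $i\ne s$). The network digraph has an edge from $j$ to $i$ iff $g_{ij}>0$. A vertex set $V_C$ is a separating cutset for $s$ if the remaining vertices can be partitioned into $V_1$ and $V_B$ such that there is no edge from $V_1$ to $V_B$ and $s\in V_1\cup V_C$. For the response from zero initial state put $E_i(T_0)=\int_0^{T_0} y_i(t)^2\,dt$. The network is called propagation stable if (1) the synchronization manifold $\{x_1=\dots=x_N\}$ of the undisturbed network is asymptotically stable in the sense of Lyapunov, and (2) for every source $s$, every disturbance $w$ satisfying the Dirichlet conditions (on every bounded interval: absolutely integrable, bounded, with finitely many discontinuities, maxima and minima), every separating cutset $V_C$ for $s$ with sets $V_1,V_B$ as above, every horizon $T_0>0$ and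 every $b\in V_B$, one has $E_b(T_0)\le\max_{c\in V_C}E_c(T_0)$ (a maximum over the empty set being $0$). Let $T(s)=C(sI-A)^{-1}B$ and $k_i=\alpha\sum_{j\ne i}g_{ij}$. Suppose that the synchronization manifold is asymptotically stable and that $$\operatorname{Re}T(j\omega)\ \ge\ -\frac{1}{2\alpha\max_i\sum_{j\neq i}g_{ij}}$$ for all real $\omega$ such that $j\omega$ is not an eigenvalue of $A$ (if the network has no edges, the right-hand side is read as $-\infty$). Then the network is propagation stable. Moreover, without any stability assumption, for each real $\omega$ such that $j\omega$ is not an eigenvalue of $A$, the displayed inequality at $\omega$ holds if and only if, for all $i$, $1+k_iT(j\omega)\neq 0$ and $\left|\dfrac{k_iT(j\omega)}{1+k_iT(j\omega)}\right|\le 1$. -/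

import Mathlib

open scoped Matrix

noncomputable section

/-- The network synchronization model with `N` identical single-input single-output linear
subsystems `(C, A, B)` with state space `ℝⁿ`, coupling weights `g i j ≥ 0` (the weight of the edge
from `j` to `i`) and global coupling strength `α`. Diagonal entries of `g` are never used. -/
structure SyncNetwork (N n : ℕ) where
  /-- state matrix of a subsystem -/
  A : Matrix (Fin n) (Fin n) ℝ
  /-- input vector of a subsystem -/
  B : Fin n → ℝ
  /-- output vector of a subsystem -/
  C : Fin n → ℝ
  /-- coupling weights -/
  g : Fin N → Fin N → ℝ
  /-- global coupling strength -/
  α : ℝ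
  g_nonneg : ∀ i j, 0 ≤ g i j

namespace SyncNetwork

variable {N n : ℕ} (net : SyncNetwork N n)

/-- The output `y = C x` of a subsystem in state `x`. -/
def output (x : Fin n → ℝ) : ℝ := net.C ⬝ᵥ x

/-- The right-hand side of the state equation of subsystem `i`,
`A xᵢ + B (α ∑_{j ≠ i} gᵢⱼ (yⱼ - yᵢ) + uᵢ)`, where `u` is the vector of external inputs. -/
def velocity (u : Fin N → ℝ) (x : Fin N → Fin n → ℝ) (i : Fin N) : Fin n → ℝ :=
  net.A *ᵥ x i +
    (net.α * (∑ j with j ≠ i, net.g i j * (net.output (x j) - net.output (x i))) + u i) • net.B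

/-- `x` is a solution on `[0, ∞)` of the network equations with external inputs `u`. As `u` may be
discontinuous, solutions are meant in the usual Carathéodory sense, through the integrated
equation. -/
def IsTrajectory (u : ℝ → Fin N → ℝ) (x : ℝ → Fin N → Fin n → ℝ) : Prop :=
  ContinuousOn x (Set.Ici 0) ∧
    ∀ t : ℝ, 0 ≤ t → ∀ i, x t i = x 0 i + ∫ τ in (0 : ℝ)..t, net.velocity (u τ) (x τ) i

/-- `x` is the zero-state response of the network to the disturbance `w` acting at node `s`. -/
def IsResponse (s : Fin N) (w : ℝ → ℝ) (x : ℝ → Fin N → Fin n → ℝ) : Prop :=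
  x 0 = 0 ∧ net.IsTrajectory (fun t => Pi.single s (w t)) x

/-- The output energy `E_i(T) = ∫₀ᵀ y_i(t)² dt` along `x`. -/
def energy (x : ℝ → Fin N → Fin n → ℝ) (T : ℝ) (i : Fin N) : ℝ :=
  ∫ t in (0 : ℝ)..T, net.output (x t i) ^ 2

/-- The synchronization manifold: all subsystems have the same state. -/
def syncManifold (N n : ℕ) : Set (Fin N → Fin n → ℝ) :=
  {x | ∀ i j, x i = x j}

/-- The synchronization manifold is asymptotically stable in the sense of Lyapunov for the
undisturbed network: it is stable and attractive. The distance is taken in the maximum norm of the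
finite-dimensional state space; any other norm gives the same notion. -/
def SyncManifoldAsympStable : Prop :=
  (∀ ε > 0, ∃ δ > 0, ∀ x : ℝ → Fin N → Fin n → ℝ, net.IsTrajectory 0 x →
      Metric.infDist (x 0) (syncManifold N n) < δ →
        ∀ t : ℝ, 0 ≤ t → Metric.infDist (x t) (syncManifold N n) < ε) ∧
  (∃ δ > 0, ∀ x : ℝ → Fin N → Fin n → ℝ, net.IsTrajectory 0 x →
      Metric.infDist (x 0) (syncManifold N n) < δ →
        Filter.Tendsto (fun t => Metric.infDist (x t) (syncManifold N n))
          Filter.atTop (nhds 0))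

/-- `VC` is a separating cutset for the source `s`, as witnessed by the partition of the remaining
vertices into `V1` and `VB`: there is no edge from `V1` to `VB` (an edge from `i` to `j` is present
iff `g j i > 0`), and `V1 ∪ VC` contains `s`. -/
structure IsSeparatingCutset (s : Fin N) (V1 VC VB : Finset (Fin N)) : Prop where
  disjoint_V1_VC : Disjoint V1 VC
  disjoint_VB_VC : Disjoint VB VC
  disjoint_V1_VB : Disjoint V1 VB
  cover : V1 ∪ VC ∪ VB = Finset.univ
  no_edge : ∀ i ∈ V1, ∀ j ∈ VB, ¬ 0 < net.g j i
  source_mem : s ∈ V1 ∪ VC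

end SyncNetwork

/-- The disturbance signals: functions of `t ≥ 0` that satisfy the Dirichlet conditions, that is,
on every bounded interval they are integrable, bounded, have finitely many discontinuities, and
finitely many maxima and minima (they are monotone between the consecutive points of some finite
set). -/
structure IsDirichletSignal (w : ℝ → ℝ) : Prop where
  integrable : ∀ T > 0, MeasureTheory.IntegrableOn w (Set.Icc 0 T)
  bounded : ∀ T > 0, ∃ M, ∀ t ∈ Set.Icc 0 T, |w t| ≤ M
  finite_discont : ∀ T > 0, {t ∈ Set.Icc 0 T | ¬ ContinuousWithinAt w (Set.Icc 0 T) t}.Finite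
  finite_extrema : ∀ T > 0, ∃ P : Finset ℝ, ∀ a b : ℝ, 0 ≤ a → a < b → b ≤ T →
    (∀ p ∈ P, p ∉ Set.Ioo a b) → MonotoneOn w (Set.Ioo a b) ∨ AntitoneOn w (Set.Ioo a b)

namespace SyncNetwork

variable {N n : ℕ} (net : SyncNetwork N n)

/-- Propagation stability: the synchronization manifold is asymptotically stable, and for every
source, disturbance, separating cutset, horizon and vertex `b` beyond the cutset, the energy at `b`
is at most the maximal energy in the cutset. (The supremum is over a finite set, so it is the
maximum; for an empty cutset it is `0`, and the inequality then says that the output at `b` has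
zero energy.) -/
def PropagationStable : Prop :=
  net.SyncManifoldAsympStable ∧
    ∀ (s : Fin N) (w : ℝ → ℝ), IsDirichletSignal w →
      ∀ x : ℝ → Fin N → Fin n → ℝ, net.IsResponse s w x →
        ∀ V1 VC VB : Finset (Fin N), net.IsSeparatingCutset s V1 VC VB →
          ∀ T : ℝ, 0 < T → ∀ b ∈ VB,
            net.energy x T b ≤ ⨆ c : VC, net.energy x T c

/-- The state matrix, with complex entries. -/
def complexA : Matrix (Fin n) (Fin n) ℂ := net.A.map (fun r : ℝ => (r : ℂ))

/-- The transfer function `T(s) = C (sI - A)⁻¹ B` of the subsystem, meaningful when `s` is not an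
eigenvalue of `A`. -/
def transfer (s : ℂ) : ℂ :=
  (fun k => (net.C k : ℂ)) ⬝ᵥ
    ((s • (1 : Matrix (Fin n) (Fin n) ℂ) - net.complexA)⁻¹ *ᵥ (fun k => (net.B k : ℂ)))

/-- Total weight `∑_{j ≠ i} g_ij` of the edges that enter `i`. -/
def inWeight (i : Fin N) : ℝ := ∑ j with j ≠ i, net.g i j

/-- `max_i ∑_{j ≠ i} g_ij`. -/
def maxInWeight : ℝ := ⨆ i, net.inWeight i

/-- The local feedback gain `k_i = α ∑_{j ≠ i} g_ij`. -/
def gain (i : Fin N) : ℝ := net.α * net.inWeight i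

/-- `Re T(jω) ≥ -1 / (2 α max_i ∑_{j ≠ i} g_ij)`; for a network without edges the right-hand side
is read as `-∞`. -/
def FrequencyBound (ω : ℝ) : Prop :=
  0 < net.maxInWeight →
    -(1 / (2 * net.α * net.maxInWeight)) ≤ (net.transfer (ω * Complex.I)).re

/-- `|k_i T(jω) / (1 + k_i T(jω))| ≤ 1` for all `i`, including that the quotients are defined. -/
def LocalRequirement (ω : ℝ) : Prop :=
  ∀ i, 1 + net.gain i * net.transfer (ω * Complex.I) ≠ 0 ∧
    ‖net.gain i * net.transfer (ω * Complex.I) /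
      (1 + net.gain i * net.transfer (ω * Complex.I))‖ ≤ 1

end SyncNetwork

end

/-! The heart is a local energy inequality. A node `i` that receives no disturbance and has incoming
edges is the loop `x' = A x + k (v - C x) B`, where `k = k_i` and `v` is the weighted mean of its
in-neighbours' outputs. From `v` to `y_i` the transfer function is `k T / (1 + k T)`. Since `|1 + k
T|² - |k T|² = 1 + 2 k Re T`, the frequency bound says exactly that this function has modulus at
most `1` on the imaginary axis, for every node. If the loop is stable, Plancherel gives `∫ y_i² ≤ ∫
v²` over `[0, T]` (`integral_output_sq_le`), and Jensen bounds `E_i` by the weighted mean of the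
in-neighbours' energies (`inWeight_mul_energy_le`).

The cutset claim is then a maximum principle. Suppose the maximal energy over `V_B` exceeds all
energies in `V_C`, and let `S` be the set of maximizers in `V_B`. In-neighbours of `S` lie in `V_B ∪
V_C`; one outside `S` would have strictly smaller energy and contradict the mean inequality. So no
edge enters `S`, its nodes never leave rest, and the maximal energy is `0`, which is absurd.

It remains to see that each loop `A - k_i B C` is stable (`isHurwitz_feedback_gain`).
Synchronization makes `A - α a B C` Hurwitz for some Laplacian eigenvalue `a`, taken on a left
eigenvector whose entries sum to zero. By Gershgorin, `α a` lies in the closed disc with diameter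
`[0, 2k]`, where `k = α max_i ∑ g_ij`, and `k_i` lies in the open disc. The frequency bound excludes
`1 + μ T(jω) = 0` for `μ` in the open disc, so along the segment from `α a` to `k_i` no eigenvalue
meets the imaginary axis, and stability is carried over. -/

/-! ### Plancherel's theorem for the Fourier integral on L¹ ∩ L². -/

section Plancherel

open MeasureTheory FourierTransform SchwartzMap
open scoped ContDiff

theorem integral_fourier_mul_eq_flip {f g : ℝ → ℂ} (hf : Integrable f) (hg : Integrable g) :
    ∫ ξ, 𝓕 f ξ * g ξ = ∫ x, f x * 𝓕 g x := by
  have h := VectorFourier.integral_fourierIntegral_smul_eq_flip (e := Real.fourierChar)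
    (μ := volume) (ν := volume) (L := innerₗ ℝ) (f := f) (g := g) Real.continuous_fourierChar
    continuous_inner hf hg
  rw [flip_innerₗ] at h
  exact h

/-- The `L²` Fourier transform of an integrable function is given by the Fourier integral. -/
theorem fourier_toLp_ae_eq {f : ℝ → ℂ} (h1 : Integrable f) (h2 : MemLp f 2) :
    ∀ᵐ ξ, (𝓕 (h2.toLp f) : Lp ℂ 2 (volume : Measure ℝ)) ξ = 𝓕 f ξ := by
  have hcont : Continuous (𝓕 f) :=
    VectorFourier.fourierIntegral_continuous Real.continuous_fourierChar
      (L := innerₗ ℝ) continuous_inner h1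
  -- It suffices to test against smooth compactly supported `g`, which are Schwartz functions. The
  -- transform moves onto `g` by definition of the distributional transform on one side, and by
  -- Fubini on the other.
  apply ae_eq_of_integral_contDiff_smul_eq
  · exact (Lp.memLp _).locallyIntegrable (by norm_num)
  · exact hcont.locallyIntegrable
  · intro g g_smooth g_cpt
    have hg₁ : HasCompactSupport (Complex.ofRealCLM ∘ g) := g_cpt.comp_left rfl
    have hg₂ : ContDiff ℝ ∞ (Complex.ofRealCLM ∘ g) := by fun_prop
    set G : 𝓢(ℝ, ℂ) := hg₁.toSchwartzMap hg₂ with hG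
    have hGg : ∀ x, G x = (g x : ℂ) := fun x => rfl
    have key := congrArg (fun D => D G) (Lp.fourier_toTemperedDistribution_eq (h2.toLp f))
    simp only [TemperedDistribution.fourier_apply, Lp.toTemperedDistribution_apply] at key
    have e1 : ∫ x, g x • (𝓕 (h2.toLp f) : Lp ℂ 2 (volume : Measure ℝ)) x
        = ∫ x, G x • (𝓕 (h2.toLp f) : Lp ℂ 2 (volume : Measure ℝ)) x := by
      refine integral_congr_ae (Filter.Eventually.of_forall fun x => ?_)
      simp [hGg]
    rw [e1, ← key]
    have e2 : ∫ x, (𝓕 G) x • (h2.toLp f) x = ∫ x, f x * 𝓕 (G : ℝ → ℂ) x := by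
      refine integral_congr_ae ?_
      filter_upwards [h2.coeFn_toLp] with x hx
      rw [hx, SchwartzMap.fourier_coe, smul_eq_mul, mul_comm]
    rw [e2, ← integral_fourier_mul_eq_flip h1 G.integrable]
    refine integral_congr_ae (Filter.Eventually.of_forall fun x => ?_)
    simp [hGg, mul_comm]

theorem memLp_fourier {f : ℝ → ℂ} (h1 : Integrable f) (h2 : MemLp f 2) : MemLp (𝓕 f) 2 :=
  (memLp_congr_ae (fourier_toLp_ae_eq h1 h2)).1 (Lp.memLp _)

theorem integral_norm_sq_toLp {f : ℝ → ℂ} (h2 : MemLp f 2) :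
    ∫ x, ‖f x‖ ^ 2 = ‖h2.toLp f‖ ^ 2 := by
  have h := L2.inner_def (𝕜 := ℂ) (h2.toLp f) (h2.toLp f)
  have h' : ∫ x, inner ℂ ((h2.toLp f : ℝ → ℂ) x) ((h2.toLp f : ℝ → ℂ) x)
      = ∫ x, ((‖f x‖ ^ 2 : ℝ) : ℂ) := by
    refine integral_congr_ae ?_
    filter_upwards [h2.coeFn_toLp] with x hx
    rw [hx, inner_self_eq_norm_sq_to_K]; simp
  rw [h', integral_complex_ofReal, inner_self_eq_norm_sq_to_K] at h
  exact Complex.ofReal_injective (h.symm.trans (by push_cast; rfl))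

/-- Plancherel's theorem for integrable and square integrable functions. -/
theorem integral_norm_sq_fourier {f : ℝ → ℂ} (h1 : Integrable f) (h2 : MemLp f 2) :
    ∫ ξ, ‖𝓕 f ξ‖ ^ 2 = ∫ x, ‖f x‖ ^ 2 := by
  rw [integral_norm_sq_toLp h2, integral_norm_sq_toLp (memLp_fourier h1 h2)]
  congr 1
  rw [← Lp.norm_fourier_eq (h2.toLp f)]
  congr 1
  refine Lp.ext ?_
  filter_upwards [(memLp_fourier h1 h2).coeFn_toLp, fourier_toLp_ae_eq h1 h2] with x hx hy
  rw [hx, hy]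

theorem integral_norm_sq_le_of_fourier_le {f g : ℝ → ℂ} (hf1 : Integrable f) (hf2 : MemLp f 2)
    (hg1 : Integrable g) (hg2 : MemLp g 2) (h : ∀ᵐ ξ, ‖𝓕 f ξ‖ ≤ ‖𝓕 g ξ‖) :
    ∫ x, ‖f x‖ ^ 2 ≤ ∫ x, ‖g x‖ ^ 2 := by
  rw [← integral_norm_sq_fourier hf1 hf2, ← integral_norm_sq_fourier hg1 hg2]
  refine integral_mono_ae ((memLp_fourier hf1 hf2).integrable_norm_pow (by norm_num))
    ((memLp_fourier hg1 hg2).integrable_norm_pow (by norm_num)) ?_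
  filter_upwards [h] with x hx
  exact pow_le_pow_left₀ (norm_nonneg _) hx 2

end Plancherel

/-! ### Exponential decay for linear systems with spectrum in the left half plane. -/

section Decay

open MeasureTheory Filter Topology

/-- A function that decays exponentially on `[0, ∞)` and solves the linear equation `φ' = M φ`. -/
structure IsDecayingSolution {E : Type*} [NormedAddCommGroup E] [NormedSpace ℂ E]
    (M : E →ₗ[ℂ] E) (φ : ℝ → E) : Prop where
  hasDerivAt : ∀ t, HasDerivAt φ (M (φ t)) t
  decay : ∃ K ε : ℝ, 0 < ε ∧ ∀ t, 0 ≤ t → ‖φ t‖ ≤ K * Real.exp (-ε * t)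

namespace IsDecayingSolution

variable {E : Type*} [NormedAddCommGroup E] [NormedSpace ℂ E] {M : E →ₗ[ℂ] E} {φ ψ : ℝ → E}

theorem zero (M : E →ₗ[ℂ] E) : IsDecayingSolution M (fun _ => (0 : E)) :=
  ⟨fun t => by simpa using hasDerivAt_const t (0 : E), 0, 1, one_pos, by simp⟩

theorem add (hφ : IsDecayingSolution M φ) (hψ : IsDecayingSolution M ψ) :
    IsDecayingSolution M (fun t => φ t + ψ t) := by
  refine ⟨fun t => by rw [map_add]; exact (hφ.hasDerivAt t).add (hψ.hasDerivAt t), ?_⟩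
  obtain ⟨K, ε, hε, h⟩ := hφ.decay
  obtain ⟨K', ε', hε', h'⟩ := hψ.decay
  have hK : 0 ≤ K := by simpa using (norm_nonneg _).trans (h 0 le_rfl)
  have hK' : 0 ≤ K' := by simpa using (norm_nonneg _).trans (h' 0 le_rfl)
  refine ⟨K + K', min ε ε', lt_min hε hε', fun t ht => (norm_add_le _ _).trans ?_⟩
  have e1 : Real.exp (-ε * t) ≤ Real.exp (-min ε ε' * t) :=
    Real.exp_le_exp.2 (by nlinarith [min_le_left ε ε'])
  have e2 : Real.exp (-ε' * t) ≤ Real.exp (-min ε ε' * t) :=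
    Real.exp_le_exp.2 (by nlinarith [min_le_right ε ε'])
  rw [add_mul]
  exact add_le_add ((h t ht).trans (by gcongr)) ((h' t ht).trans (by gcongr))

end IsDecayingSolution

/-- The Taylor polynomial of the exponential of a nilpotent operator `P`, applied to `ξ`. -/
theorem hasDerivAt_sum_pow_div_factorial {E : Type*} [NormedAddCommGroup E] [NormedSpace ℂ E]
    (P : E →ₗ[ℂ] E) (ξ : E) (m : ℕ) (t : ℝ) :
    HasDerivAt (fun t : ℝ => ∑ k ∈ Finset.range (m + 1),
        ((t : ℂ) ^ k / (k.factorial : ℂ)) • (P ^ k) ξ)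
      (∑ k ∈ Finset.range m, ((t : ℂ) ^ k / (k.factorial : ℂ)) • (P ^ (k + 1)) ξ) t := by
  have h : ∀ k : ℕ, HasDerivAt
      (fun t : ℝ => ((t : ℂ) ^ (k + 1) / ((k + 1).factorial : ℂ)) • (P ^ (k + 1)) ξ)
      (((t : ℂ) ^ k / (k.factorial : ℂ)) • (P ^ (k + 1)) ξ) t := by
    intro k
    refine HasDerivAt.smul_const ?_ _
    have h1 : HasDerivAt (fun t : ℝ => (t : ℂ) ^ (k + 1)) (((k + 1 : ℕ) : ℂ) * (t : ℂ) ^ k) t := by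
      simpa using (hasDerivAt_pow (k + 1) (t : ℂ)).comp_ofReal
    have h2 := h1.div_const ((k + 1).factorial : ℂ)
    convert h2 using 1
    rw [Nat.factorial_succ]
    have : (k.factorial : ℂ) ≠ 0 := by exact_mod_cast k.factorial_ne_zero
    have : ((k : ℂ) + 1) ≠ 0 := by exact_mod_cast k.succ_ne_zero
    push_cast
    field_simp
  have h3 := HasDerivAt.fun_sum (u := Finset.range m) (fun k _ => h k)
  have h4 := h3.add_const ((P ^ 0) ξ)
  refine h4.congr_of_eventuallyEq (Eventually.of_forall fun s => ?_)
  simp [Finset.sum_range_succ']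

/-- On a generalized eigenvector the exponential series of the nilpotent part terminates, so the
solution is `exp (z t)` times a polynomial, and half of the decay rate absorbs the polynomial. -/
theorem exists_isDecayingSolution_of_pow_eq_zero {E : Type*} [NormedAddCommGroup E]
    [NormedSpace ℂ E] (M : E →ₗ[ℂ] E) {z : ℂ} (hz : z.re < 0) {ξ : E} {m : ℕ}
    (hξ : ((M - algebraMap ℂ (Module.End ℂ E) z) ^ m) ξ = 0) :
    ∃ φ, φ 0 = ξ ∧ IsDecayingSolution M φ := by
  set P : Module.End ℂ E := M - algebraMap ℂ (Module.End ℂ E) z with hP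
  have hM : ∀ x, M x = z • x + P x := fun x => by simp [hP]
  -- The term `k = m` vanishes by `hξ`. It is kept so that the derivative, a sum over `range m`, is
  -- visibly `P (S t)`.
  set S : ℝ → E := fun t => ∑ k ∈ Finset.range (m + 1),
        ((t : ℂ) ^ k / (k.factorial : ℂ)) • (P ^ k) ξ with hS
  have hPS : ∀ t, P (S t) =
      ∑ k ∈ Finset.range m, ((t : ℂ) ^ k / (k.factorial : ℂ)) • (P ^ (k + 1)) ξ := by
    intro t
    simp only [hS, Finset.sum_range_succ]
    rw [hξ, smul_zero, add_zero, map_sum]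
    simp [pow_succ']
  refine ⟨fun t => Complex.exp (z * t) • S t, ?_, fun t => ?_, ?_⟩
  · simp [hS, Finset.sum_range_succ']
  · have h1 : HasDerivAt (fun t : ℝ => Complex.exp (z * t)) (Complex.exp (z * t) * z) t := by
      have := ((hasDerivAt_id (t : ℂ)).const_mul z).cexp.comp_ofReal
      simpa using this
    have h2 : HasDerivAt (fun t : ℝ => Complex.exp (z * t) • S t) _ t :=
      h1.smul (hasDerivAt_sum_pow_div_factorial P ξ m t)
    rw [hM, map_smul, hPS, smul_smul, mul_comm z, add_comm]
    exact h2
  · set c := -z.re with hc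
    have hc0 : 0 < c := by simp [hc, hz]
    have hbound : ∀ k : ℕ, ∃ K : ℝ, ∀ t : ℝ, 0 ≤ t → t ^ k * Real.exp (-c * t) ≤
        K * Real.exp (-(c / 2) * t) := by
      intro k
      -- The constant comes from `x ^ k / k! ≤ exp x` at `x = c t / 2`.
      refine ⟨k.factorial / (c / 2) ^ k, fun t ht => ?_⟩
      have h1 := Real.pow_div_factorial_le_exp (c / 2 * t) (by positivity) k
      have h2 : t ^ k ≤ k.factorial / (c / 2) ^ k * Real.exp (c / 2 * t) := by
        rw [mul_pow] at h1
        have hf : (0 : ℝ) < k.factorial := by exact_mod_cast k.factorial_pos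
        have hp : 0 < (c / 2) ^ k := by positivity
        rw [div_le_iff₀ hf] at h1
        rw [div_mul_eq_mul_div, le_div_iff₀ hp]
        linarith
      calc t ^ k * Real.exp (-c * t)
          ≤ (k.factorial / (c / 2) ^ k * Real.exp (c / 2 * t)) * Real.exp (-c * t) := by gcongr
        _ = _ := by rw [mul_assoc, ← Real.exp_add]; congr 2; ring
    choose K hK using hbound
    refine ⟨∑ k ∈ Finset.range (m + 1), K k * ‖((k.factorial : ℂ)⁻¹) • (P ^ k) ξ‖, c / 2,
      by positivity, fun t ht => ?_⟩
    have hexp : ‖Complex.exp (z * t)‖ = Real.exp (-c * t) := by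
      rw [Complex.norm_exp]; simp [hc]
    rw [norm_smul, hexp, Finset.sum_mul, mul_comm]
    refine (mul_le_mul_of_nonneg_right (norm_sum_le _ _) (Real.exp_pos _).le).trans ?_
    rw [Finset.sum_mul]
    refine Finset.sum_le_sum fun k _ => ?_
    have : ‖((t : ℂ) ^ k / (k.factorial : ℂ)) • (P ^ k) ξ‖
        = t ^ k * ‖((k.factorial : ℂ)⁻¹) • (P ^ k) ξ‖ := by
      rw [div_eq_mul_inv, mul_smul, norm_smul, norm_pow, Complex.norm_real, Real.norm_of_nonneg ht]
    rw [this]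
    calc _ = (t ^ k * Real.exp (-c * t)) * ‖((k.factorial : ℂ)⁻¹) • (P ^ k) ξ‖ := by ring
      _ ≤ (K k * Real.exp (-(c / 2) * t)) * ‖((k.factorial : ℂ)⁻¹) • (P ^ k) ξ‖ :=
          mul_le_mul_of_nonneg_right (hK k t ht) (norm_nonneg _)
      _ = _ := by ring

/-- If all eigenvalues of `M` have negative real part, then all solutions of `φ' = M φ` decay
exponentially. -/
theorem exists_isDecayingSolution {E : Type*} [NormedAddCommGroup E] [NormedSpace ℂ E]
    [FiniteDimensional ℂ E] (M : Module.End ℂ E)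
    (hM : ∀ z : ℂ, M.HasEigenvalue z → z.re < 0) (ξ : E) :
    ∃ φ, φ 0 = ξ ∧ IsDecayingSolution M φ := by
  have htop : ξ ∈ ⨆ z, M.maxGenEigenspace z := by
    rw [Module.End.iSup_maxGenEigenspace_eq_top]; trivial
  induction htop using Submodule.iSup_induction' with
  | zero => exact ⟨_, rfl, IsDecayingSolution.zero M⟩
  | add x y _ _ hx hy =>
    obtain ⟨φ, h0, hφ⟩ := hx
    obtain ⟨ψ, h0', hψ⟩ := hy
    exact ⟨_, by simp [h0, h0'], hφ.add hψ⟩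
  | mem z x hx =>
    by_cases hx0 : x = 0
    · exact ⟨_, hx0.symm, IsDecayingSolution.zero M⟩
    obtain ⟨m, hm⟩ := (Module.End.mem_maxGenEigenspace M z x).1 hx
    have hz : M.HasEigenvalue z := by
      refine Module.End.hasEigenvalue_of_hasGenEigenvalue (k := m) ?_
      rw [Module.End.hasGenEigenvalue_iff]
      intro hbot
      apply hx0
      have : x ∈ M.genEigenspace z m := (Module.End.mem_genEigenspace_nat).2 hm
      rwa [hbot] at this
    exact exists_isDecayingSolution_of_pow_eq_zero M (hM z hz) hm

end Decay

/-! ### Energy gain of a stable feedback loop over a finite horizon. -/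

section Gain

open MeasureTheory Filter Topology FourierTransform

theorem memLp_indicator_Ioc_of_continuousOn {f : ℝ → ℂ} {T : ℝ} (p : ENNReal)
    (hf : ContinuousOn f (Set.Icc 0 T)) : MemLp ((Set.Ioc 0 T).indicator f) p := by
  obtain ⟨K, hK⟩ := isCompact_Icc.exists_bound_of_continuousOn hf
  rw [memLp_indicator_iff_restrict measurableSet_Ioc]
  refine MemLp.of_bound
    ((hf.mono Set.Ioc_subset_Icc_self).aestronglyMeasurable measurableSet_Ioc) K ?_
  refine (ae_restrict_iff' measurableSet_Ioc).2 (Eventually.of_forall fun t ht => ?_)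
  exact hK t (Set.Ioc_subset_Icc_self ht)

theorem memLp_indicator_Ioi_of_decay {f : ℝ → ℂ} {T K ε : ℝ} (hf : Continuous f) (hε : 0 < ε)
    (h : ∀ t, T ≤ t → ‖f t‖ ≤ K * Real.exp (-ε * t)) :
    Integrable ((Set.Ioi T).indicator f) ∧ MemLp ((Set.Ioi T).indicator f) 2 := by
  have hmeas : AEStronglyMeasurable f (volume.restrict (Set.Ioi T)) := hf.aestronglyMeasurable
  constructor
  · rw [integrable_indicator_iff measurableSet_Ioi]
    refine Integrable.mono' ((integrableOn_exp_mul_Ioi (neg_lt_zero.2 hε) T).const_mul K) hmeas ?_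
    refine (ae_restrict_iff' measurableSet_Ioi).2 (Eventually.of_forall fun t ht => ?_)
    exact h t (le_of_lt ht)
  · rw [memLp_indicator_iff_restrict measurableSet_Ioi, memLp_two_iff_integrable_sq_norm hmeas]
    refine Integrable.mono' ((integrableOn_exp_mul_Ioi
      (neg_lt_zero.2 (by positivity : 0 < 2 * ε)) T).const_mul (K ^ 2)) (hmeas.norm.pow 2) ?_
    refine (ae_restrict_iff' measurableSet_Ioi).2 (Eventually.of_forall fun t ht => ?_)
    rw [Real.norm_of_nonneg (by positivity)]
    calc ‖f t‖ ^ 2 ≤ (K * Real.exp (-ε * t)) ^ 2 :=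
          pow_le_pow_left₀ (norm_nonneg _) (h t (le_of_lt ht)) 2
      _ = K ^ 2 * Real.exp (-(2 * ε) * t) := by
          rw [mul_pow, ← Real.exp_nat_mul]; congr 2; push_cast; ring

theorem HasDerivAt.dotProduct_const {n : ℕ} {Z : ℝ → Fin n → ℂ} {Z' : Fin n → ℂ} {t : ℝ}
    (h : HasDerivAt Z Z' t) (l : Fin n → ℂ) :
    HasDerivAt (fun t => l ⬝ᵥ Z t) (l ⬝ᵥ Z') t := by
  simp only [dotProduct]
  exact HasDerivAt.fun_sum fun i _ => ((hasDerivAt_pi.1 h) i).const_mul (l i)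

theorem norm_dotProduct_le {n : ℕ} (l x : Fin n → ℂ) : ‖l ⬝ᵥ x‖ ≤ (∑ i, ‖l i‖) * ‖x‖ := by
  rw [Finset.sum_mul]
  refine (norm_sum_le _ _).trans (Finset.sum_le_sum fun i _ => ?_)
  rw [norm_mul]
  exact mul_le_mul_of_nonneg_left (norm_le_pi_norm x i) (norm_nonneg _)

/-- The scalar functional `l = c (zI - A)⁻¹` through which the transfer function acts. -/
theorem exists_resolvent_functional {n : ℕ} {A : Matrix (Fin n) (Fin n) ℂ} (b c : Fin n → ℂ)
    {z : ℂ} (hz : z ∉ spectrum ℂ A) :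
    ∃ l : Fin n → ℂ, (∀ x, l ⬝ᵥ (A *ᵥ x) = z * (l ⬝ᵥ x) - c ⬝ᵥ x) ∧
      l ⬝ᵥ b = c ⬝ᵥ ((z • (1 : Matrix (Fin n) (Fin n) ℂ) - A)⁻¹ *ᵥ b) := by
  set R := z • (1 : Matrix (Fin n) (Fin n) ℂ) - A with hR
  have hu : IsUnit R := by
    rw [spectrum.notMem_iff, Algebra.algebraMap_eq_smul_one] at hz
    exact hz
  have hinv : R⁻¹ * R = 1 := Matrix.nonsing_inv_mul _ ((Matrix.isUnit_iff_isUnit_det R).1 hu)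
  refine ⟨c ᵥ* R⁻¹, fun x => ?_, (Matrix.dotProduct_mulVec _ _ _).symm⟩
  have h1 : A *ᵥ x = z • x - R *ᵥ x := by
    rw [hR, Matrix.sub_mulVec, Matrix.smul_mulVec, Matrix.one_mulVec]; abel
  rw [h1, dotProduct_sub, dotProduct_smul, smul_eq_mul, Matrix.dotProduct_mulVec,
    Matrix.vecMul_vecMul, hinv, Matrix.vecMul_one]

/-- The Fourier transform of a solution of `s' = iω s + r` on `[0, T]`, `s(0) = 0`, that is
continued on `[T, ∞)` by a decaying solution of the same kind. -/
theorem integral_exp_mul_forcing_eq_zero {ω T : ℝ} (hT : 0 ≤ T) {s r s₂ r₂ : ℝ → ℂ}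
    (hs : ∀ t ∈ Set.Icc 0 T, HasDerivAt s (ω * Complex.I * s t + r t) t)
    (hs₂ : ∀ t, HasDerivAt s₂ (ω * Complex.I * s₂ t + r₂ t) t)
    (h0 : s 0 = 0) (hsT : s₂ T = s T) (hr : ContinuousOn r (Set.Icc 0 T))
    (hr₂ : IntegrableOn r₂ (Set.Ioi T)) (hlim : Tendsto s₂ atTop (𝓝 0)) :
    (∫ t in Set.Ioc 0 T, Complex.exp (-(ω * Complex.I) * t) * r t) +
      ∫ t in Set.Ioi T, Complex.exp (-(ω * Complex.I) * t) * r₂ t = 0 := by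
  have hexp : ∀ t : ℝ, HasDerivAt (fun t : ℝ => Complex.exp (-(ω * Complex.I) * t))
      (Complex.exp (-(ω * Complex.I) * t) * (-(ω * Complex.I))) t := by
    intro t
    have := ((hasDerivAt_id (t : ℂ)).const_mul (-(ω * Complex.I))).cexp.comp_ofReal
    simpa using this
  have hcexp : Continuous (fun t : ℝ => Complex.exp (-(ω * Complex.I) * t)) := by fun_prop
  have hnorm : ∀ t : ℝ, ‖Complex.exp (-(ω * Complex.I) * t)‖ = 1 := by
    intro t; rw [Complex.norm_exp]; simp
  -- The integrating factor turns each forcing term into an exact derivative; the boundary terms at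
  -- `T` cancel because `s₂ T = s T`.
  have h1 : ∫ t in (0 : ℝ)..T, Complex.exp (-(ω * Complex.I) * t) * r t
      = Complex.exp (-(ω * Complex.I) * T) * s T := by
    rw [intervalIntegral.integral_eq_sub_of_hasDerivAt
      (f := fun t : ℝ => Complex.exp (-(ω * Complex.I) * t) * s t)]
    · simp [h0]
    · intro t ht
      rw [Set.uIcc_of_le hT] at ht
      exact ((hexp t).mul (hs t ht)).congr_deriv (by ring)
    · apply ContinuousOn.intervalIntegrable
      rw [Set.uIcc_of_le hT]
      exact hcexp.continuousOn.mul hr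
  have h2 : ∫ t in Set.Ioi T, Complex.exp (-(ω * Complex.I) * t) * r₂ t
      = 0 - Complex.exp (-(ω * Complex.I) * T) * s₂ T := by
    refine integral_Ioi_of_hasDerivAt_of_tendsto'
      (f := fun t : ℝ => Complex.exp (-(ω * Complex.I) * t) * s₂ t) ?_ ?_ ?_
    · intro t _
      exact ((hexp t).mul (hs₂ t)).congr_deriv (by ring)
    · refine hr₂.norm.mono' (hcexp.aestronglyMeasurable.mul hr₂.aestronglyMeasurable) ?_
      exact Eventually.of_forall fun t => by rw [norm_mul, hnorm, one_mul]
    · rw [tendsto_zero_iff_norm_tendsto_zero] at hlim ⊢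
      refine hlim.congr fun t => ?_
      rw [norm_mul, hnorm, one_mul]
  rw [← intervalIntegral.integral_of_le hT, h1, h2, hsT]
  ring

theorem fourier_real_eq_integral_exp_mul (f : ℝ → ℂ) (ξ : ℝ) :
    𝓕 f ξ = ∫ t : ℝ, Complex.exp (-(((2 * Real.pi * ξ : ℝ) : ℂ) * Complex.I) * t) * f t := by
  rw [Real.fourier_real_eq_integral_exp_smul]
  congr 1; ext t
  rw [smul_eq_mul]; congr 2; push_cast; ring

theorem integral_mul_indicator {S : Set ℝ} (hS : MeasurableSet S) (e f : ℝ → ℂ) :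
    ∫ t, e t * S.indicator f t = ∫ t in S, e t * f t := by
  rw [← integral_indicator hS]
  congr 1; ext t
  by_cases h : t ∈ S <;> simp [h]

theorem MeasureTheory.Integrable.exp_mul {f : ℝ → ℂ} (hf : Integrable f) (ω : ℝ) :
    Integrable (fun t : ℝ => Complex.exp (-(ω * Complex.I) * t) * f t) := by
  have hcexp : Continuous (fun t : ℝ => Complex.exp (-(ω * Complex.I) * t)) := by fun_prop
  refine hf.norm.mono' (hcexp.aestronglyMeasurable.mul hf.aestronglyMeasurable) ?_
  refine Eventually.of_forall fun t => ?_
  rw [norm_mul, Complex.norm_exp]; simp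

/-- The spectrum is finite, so the frequencies at which the transfer function is undefined form a
null set and do not matter for Plancherel. -/
theorem ae_notMem_spectrum {n : ℕ} (A : Matrix (Fin n) (Fin n) ℂ) :
    ∀ᵐ ξ : ℝ, (((2 * Real.pi * ξ : ℝ) : ℂ) * Complex.I) ∉ spectrum ℂ A := by
  have hfin : {ξ : ℝ | (((2 * Real.pi * ξ : ℝ) : ℂ) * Complex.I) ∈ spectrum ℂ A}.Finite := by
    refine Set.Finite.preimage ?_ (Matrix.finite_spectrum A)
    intro x _ y _ hxy
    have := mul_right_cancel₀ Complex.I_ne_zero hxy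
    have := Complex.ofReal_injective this
    have hpi := Real.pi_pos
    exact mul_left_cancel₀ (by positivity) this
  rw [ae_iff]
  simpa using hfin.measure_zero volume

/-- A stable feedback loop `x' = A x + k (v - c x) b` whose complementary sensitivity function is
bounded by `1` on the imaginary axis does not amplify the energy of `v` over a finite horizon. -/
theorem integral_output_sq_le {n : ℕ} {A : Matrix (Fin n) (Fin n) ℂ} {b c : Fin n → ℂ} {k : ℂ}
    (hstab : ∀ (z : ℂ) (x : Fin n → ℂ), x ≠ 0 → A *ᵥ x - (k * (c ⬝ᵥ x)) • b = z • x → z.re < 0)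
    {G : ℂ → ℂ} (hG : G = fun z => c ⬝ᵥ ((z • (1 : Matrix (Fin n) (Fin n) ℂ) - A)⁻¹ *ᵥ b))
    (hgain : ∀ ω : ℝ, (ω * Complex.I : ℂ) ∉ spectrum ℂ A →
      1 + k * G (ω * Complex.I) ≠ 0 ∧
        ‖k * G (ω * Complex.I) / (1 + k * G (ω * Complex.I))‖ ≤ 1)
    {T : ℝ} (hT : 0 ≤ T) {Z : ℝ → Fin n → ℂ} {v : ℝ → ℂ} (hv : ContinuousOn v (Set.Icc 0 T))
    (hZ0 : Z 0 = 0) (hZ : ∀ t ∈ Set.Icc 0 T,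
      HasDerivAt Z (A *ᵥ Z t + (k * (v t - c ⬝ᵥ Z t)) • b) t) :
    ∫ t in (0 : ℝ)..T, ‖c ⬝ᵥ Z t‖ ^ 2 ≤ ∫ t in (0 : ℝ)..T, ‖v t‖ ^ 2 := by
  set M : Module.End ℂ (Fin n → ℂ) := Matrix.toLin' (A - k • Matrix.vecMulVec b c) with hM
  have hMx : ∀ x, M x = A *ᵥ x - (k * (c ⬝ᵥ x)) • b := by
    intro x
    rw [hM, Matrix.toLin'_apply, Matrix.sub_mulVec, Matrix.smul_mulVec,
      Matrix.vecMulVec_mulVec, mul_smul]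
    simp
  -- After time `T` the input is cut to zero and the loop runs freely from `Z T`. Causality leaves
  -- the output on `[0, T]` unchanged, and stability makes the prolonged output integrable and
  -- square integrable.
  obtain ⟨φ, hφ0, hφ⟩ := exists_isDecayingSolution M (fun z hz => by
    obtain ⟨x, hx⟩ := hz.exists_hasEigenvector
    refine hstab z x hx.2 ?_
    rw [← hMx]; exact hx.apply_eq_smul) (Z T)
  set y : ℝ → ℂ := fun t => c ⬝ᵥ Z t with hy
  set y₂ : ℝ → ℂ := fun t => c ⬝ᵥ φ (t - T) with hy₂
  have hycont : ContinuousOn y (Set.Icc 0 T) := by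
    intro t ht
    exact ((hZ t ht).dotProduct_const c).continuousAt.continuousWithinAt
  have hφshift : ∀ t, HasDerivAt (fun t => φ (t - T)) (M (φ (t - T))) t := fun t =>
    (hφ.hasDerivAt (t - T)).comp_sub_const t T
  have hdecay : ∀ l : Fin n → ℂ, ∃ K ε : ℝ, 0 < ε ∧
      ∀ t, T ≤ t → ‖l ⬝ᵥ φ (t - T)‖ ≤ K * Real.exp (-ε * t) := by
    intro l
    obtain ⟨K, ε, hε, h⟩ := hφ.decay
    refine ⟨(∑ i, ‖l i‖) * K * Real.exp (ε * T), ε, hε, fun t ht => ?_⟩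
    refine (norm_dotProduct_le _ _).trans ?_
    have h' := h (t - T) (by linarith)
    calc (∑ i, ‖l i‖) * ‖φ (t - T)‖
        ≤ (∑ i, ‖l i‖) * (K * Real.exp (-ε * (t - T))) :=
          mul_le_mul_of_nonneg_left h' (Finset.sum_nonneg fun i _ => norm_nonneg _)
      _ = _ := by
          rw [show -ε * (t - T) = ε * T + -ε * t by ring, Real.exp_add]; ring
  have hy₂cont : Continuous y₂ := continuous_iff_continuousAt.2 fun t =>
    ((hφshift t).dotProduct_const c).continuousAt
  obtain ⟨K, ε, hε, hK⟩ := hdecay c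
  obtain ⟨hy₂1, hy₂2⟩ := memLp_indicator_Ioi_of_decay hy₂cont hε hK
  have hy1 : Integrable ((Set.Ioc 0 T).indicator y) :=
    memLp_one_iff_integrable.1 (memLp_indicator_Ioc_of_continuousOn 1 hycont)
  have hy2 := memLp_indicator_Ioc_of_continuousOn 2 hycont
  have hv1 : Integrable ((Set.Ioc 0 T).indicator v) :=
    memLp_one_iff_integrable.1 (memLp_indicator_Ioc_of_continuousOn 1 hv)
  have hv2 := memLp_indicator_Ioc_of_continuousOn 2 hv
  have hmain := integral_norm_sq_le_of_fourier_le (hy1.add hy₂1) (hy2.add hy₂2) hv1 hv2 (by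
    filter_upwards [ae_notMem_spectrum A] with ξ hξ
    obtain ⟨l, hl, hlb⟩ := exists_resolvent_functional b c hξ
    obtain ⟨hne, hle⟩ := hgain _ hξ
    set ω : ℝ := 2 * Real.pi * ξ with hω
    set g : ℂ := G (ω * Complex.I) with hg
    have hlb' : l ⬝ᵥ b = g := by rw [hlb, hg, hG]
    set e : ℝ → ℂ := fun t => Complex.exp (-(ω * Complex.I) * t) with he
    obtain ⟨K', ε', hε', hK'⟩ := hdecay l
    -- Pairing the state with `l` gives a scalar `s` with `s' = iω s - (1 + k g) y + k g v`. The
    -- conclusion is the relation `(1 + k g) ŷ = k g v̂` between the transforms, with no Laplace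
    -- transform needed.
    have hzero := integral_exp_mul_forcing_eq_zero (ω := ω) hT
      (s := fun t => l ⬝ᵥ Z t) (r := fun t => -((1 + k * g) * y t) + k * g * v t)
      (s₂ := fun t => l ⬝ᵥ φ (t - T)) (r₂ := fun t => -((1 + k * g) * y₂ t))
      (fun t ht => by
        convert (hZ t ht).dotProduct_const l using 1
        rw [dotProduct_add, dotProduct_smul, hl, hlb', smul_eq_mul]; ring)
      (fun t => by
        convert (hφshift t).dotProduct_const l using 1
        rw [hMx, dotProduct_sub, dotProduct_smul, hl, hlb', smul_eq_mul]; ring)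
      (by simp [hZ0]) (by simp [hφ0])
      ((hycont.const_mul _).neg.add (hv.const_mul _))
      (((integrable_indicator_iff measurableSet_Ioi).1 hy₂1).const_mul _).neg
      (by
        rw [tendsto_zero_iff_norm_tendsto_zero]
        refine squeeze_zero' (Eventually.of_forall fun t => norm_nonneg _)
          ((eventually_ge_atTop T).mono fun t ht => hK' t ht) ?_
        have : Tendsto (fun t : ℝ => Real.exp (-ε' * t)) atTop (𝓝 0) :=
          Real.tendsto_exp_atBot.comp (tendsto_id.const_mul_atTop_of_neg (neg_lt_zero.2 hε'))
        simpa using this.const_mul K')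
    have hIoc : ∀ f : ℝ → ℂ, Integrable ((Set.Ioc 0 T).indicator f) →
        IntegrableOn (fun t => e t * f t) (Set.Ioc 0 T) := by
      intro f hf
      rw [← integrable_indicator_iff measurableSet_Ioc]
      refine (hf.exp_mul ω).congr (Eventually.of_forall fun t => ?_)
      by_cases h : t ∈ Set.Ioc 0 T <;> simp [h, he]
    have ey : 𝓕 ((Set.Ioc 0 T).indicator y + (Set.Ioi T).indicator y₂) ξ
        = (∫ t in Set.Ioc 0 T, e t * y t) + ∫ t in Set.Ioi T, e t * y₂ t := by
      rw [fourier_real_eq_integral_exp_mul, ← integral_mul_indicator measurableSet_Ioc,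
        ← integral_mul_indicator measurableSet_Ioi,
        ← integral_add (hy1.exp_mul ω) (hy₂1.exp_mul ω)]
      congr 1; ext t
      rw [Pi.add_apply, mul_add]
    have ev : 𝓕 ((Set.Ioc 0 T).indicator v) ξ = ∫ t in Set.Ioc 0 T, e t * v t := by
      rw [fourier_real_eq_integral_exp_mul, ← integral_mul_indicator measurableSet_Ioc]
    have e1 : (∫ t in Set.Ioc 0 T, e t * (-((1 + k * g) * y t) + k * g * v t))
        = -(1 + k * g) * (∫ t in Set.Ioc 0 T, e t * y t)
          + k * g * ∫ t in Set.Ioc 0 T, e t * v t := by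
      rw [← integral_const_mul, ← integral_const_mul,
        ← integral_add ((hIoc y hy1).const_mul _) ((hIoc v hv1).const_mul _)]
      congr 1; ext t; ring
    have e2 : (∫ t in Set.Ioi T, e t * (-((1 + k * g) * y₂ t)))
        = -(1 + k * g) * ∫ t in Set.Ioi T, e t * y₂ t := by
      rw [← integral_const_mul]
      congr 1; ext t; ring
    rw [e1, e2] at hzero
    have hfin : 𝓕 ((Set.Ioc 0 T).indicator y + (Set.Ioi T).indicator y₂) ξ
        = k * g / (1 + k * g) * 𝓕 ((Set.Ioc 0 T).indicator v) ξ := by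
      rw [ey, ev, div_mul_eq_mul_div, eq_div_iff hne]
      linear_combination -hzero
    rw [hfin, norm_mul]
    exact mul_le_of_le_one_left (norm_nonneg _) hle)
  have hR : ∫ t, ‖(Set.Ioc 0 T).indicator v t‖ ^ 2 = ∫ t in (0 : ℝ)..T, ‖v t‖ ^ 2 := by
    rw [intervalIntegral.integral_of_le hT, ← integral_indicator measurableSet_Ioc]
    congr 1; ext t
    by_cases h : t ∈ Set.Ioc 0 T <;> simp [h]
  -- The energy of the free tail after `T` is nonnegative and is discarded.
  have hL : ∫ t in (0 : ℝ)..T, ‖y t‖ ^ 2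
      ≤ ∫ t, ‖((Set.Ioc 0 T).indicator y + (Set.Ioi T).indicator y₂) t‖ ^ 2 := by
    rw [intervalIntegral.integral_of_le hT]
    have : ∫ t in Set.Ioc 0 T, ‖y t‖ ^ 2 = ∫ t in Set.Ioc 0 T,
        ‖((Set.Ioc 0 T).indicator y + (Set.Ioi T).indicator y₂) t‖ ^ 2 := by
      refine setIntegral_congr_fun measurableSet_Ioc fun t ht => ?_
      have h2 : t ∉ Set.Ioi T := by simpa using ht.2
      simp [Set.indicator_of_mem ht, Set.indicator_of_notMem h2]
    rw [this]
    exact setIntegral_le_integral ((hy2.add hy₂2).integrable_norm_pow (by norm_num))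
      (Eventually.of_forall fun t => by positivity)
  exact hL.trans (hmain.trans hR.le)

end Gain

/-! ### Continuity of eigenvalues and stability along a path of matrices. -/

section Spectrum

open Filter Topology

variable {n : ℕ} {M : Matrix (Fin n) (Fin n) ℂ} {z : ℂ}

theorem mem_spectrum_iff_det_eq_zero :
    z ∈ spectrum ℂ M ↔ (z • (1 : Matrix (Fin n) (Fin n) ℂ) - M).det = 0 := by
  rw [spectrum.mem_iff, Algebra.algebraMap_eq_smul_one, Matrix.isUnit_iff_isUnit_det,
    isUnit_iff_ne_zero, not_not]

theorem mem_spectrum_iff_exists_mulVec : z ∈ spectrum ℂ M ↔ ∃ x, x ≠ 0 ∧ M *ᵥ x = z • x := by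
  rw [mem_spectrum_iff_det_eq_zero, ← Matrix.exists_mulVec_eq_zero_iff]
  refine exists_congr fun x => and_congr_right fun _ => ?_
  rw [Matrix.sub_mulVec, Matrix.smul_mulVec, Matrix.one_mulVec, sub_eq_zero, eq_comm]

theorem mem_spectrum_iff_exists_vecMul : z ∈ spectrum ℂ M ↔ ∃ x, x ≠ 0 ∧ x ᵥ* M = z • x := by
  rw [mem_spectrum_iff_det_eq_zero, ← Matrix.exists_vecMul_eq_zero_iff]
  refine exists_congr fun x => and_congr_right fun _ => ?_
  rw [Matrix.vecMul_sub, Matrix.vecMul_smul, Matrix.vecMul_one, sub_eq_zero, eq_comm]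

/-- A crude bound, but continuous in the matrix: it confines the eigenvalues along a compact path to
one ball. -/
theorem norm_le_of_mem_spectrum (h : z ∈ spectrum ℂ M) : ‖z‖ ≤ ∑ i, ∑ j, ‖M i j‖ := by
  obtain ⟨x, hx0, hx⟩ := mem_spectrum_iff_exists_mulVec.1 h
  have hpos : 0 < ‖x‖ := norm_pos_iff.2 hx0
  refine le_of_mul_le_mul_right ?_ hpos
  rw [← norm_smul, ← hx]
  refine (pi_norm_le_iff_of_nonneg (by positivity)).2 fun i => ?_
  refine (norm_dotProduct_le (M i) x).trans ?_
  refine mul_le_mul_of_nonneg_right ?_ (norm_nonneg x)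
  exact Finset.single_le_sum (f := fun i => ∑ j, ‖M i j‖)
    (fun i _ => Finset.sum_nonneg fun j _ => norm_nonneg _) (Finset.mem_univ i)

/-- `p(z)` is the product of the `z - r` over the roots, so if every factor had norm at least `δ`,
the value would have norm at least `δ ^ deg p`. This is a quantitative form of the continuity of
roots. -/
theorem Polynomial.Monic.exists_isRoot_norm_sub_lt {p : Polynomial ℂ} (hp : p.Monic) {z : ℂ}
    {δ : ℝ} (hδ : 0 < δ) (h : ‖p.eval z‖ < δ ^ p.natDegree) :
    ∃ r, p.IsRoot r ∧ ‖z - r‖ < δ := by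
  by_contra! hcon
  have hs : p.Splits := IsAlgClosed.splits p
  rw [hs.eval_eq_prod_roots_of_monic hp, hs.natDegree_eq_card_roots] at h
  refine absurd h (not_lt.2 ?_)
  have h1 : ∀ s : Multiset ℂ, (∀ r ∈ s, δ ≤ ‖z - r‖) →
      δ ^ s.card ≤ ‖(s.map (fun r => z - r)).prod‖ := by
    intro s
    induction s using Multiset.induction_on with
    | empty => simp
    | cons a s ih =>
      intro hs
      rw [Multiset.card_cons, pow_succ', Multiset.map_cons, Multiset.prod_cons, norm_mul]
      exact mul_le_mul (hs a (Multiset.mem_cons_self a s))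
        (ih fun r hr => hs r (Multiset.mem_cons_of_mem hr)) (by positivity) (norm_nonneg _)
  exact h1 _ fun r hr => hcon r ((Polynomial.mem_roots hp.ne_zero).1 hr)

theorem exists_mem_spectrum_norm_sub_lt {δ : ℝ} (hδ : 0 < δ)
    (h : ‖(z • (1 : Matrix (Fin n) (Fin n) ℂ) - M).det‖ < δ ^ n) :
    ∃ r ∈ spectrum ℂ M, ‖z - r‖ < δ := by
  obtain ⟨r, hr, hlt⟩ := M.charpoly_monic.exists_isRoot_norm_sub_lt (z := z) hδ (by
    rw [Matrix.charpoly_natDegree_eq_dim, Fintype.card_fin, Matrix.eval_charpoly,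
      Matrix.scalar_apply, ← Matrix.smul_one_eq_diagonal]
    exact h)
  exact ⟨r, Matrix.mem_spectrum_iff_isRoot_charpoly.2 hr, hlt⟩

/-- All eigenvalues lie in the open left half plane. -/
def IsHurwitz (M : Matrix (Fin n) (Fin n) ℂ) : Prop := ∀ z ∈ spectrum ℂ M, z.re < 0

/-- Along a path of matrices, eigenvalues can leave the open left half plane only through the
imaginary axis. -/
theorem IsHurwitz.of_path {M : ℝ → Matrix (Fin n) (Fin n) ℂ} (hM : Continuous M)
    (h0 : IsHurwitz (M 0))
    (haxis : ∀ t ∈ Set.Ioc (0 : ℝ) 1, ∀ z ∈ spectrum ℂ (M t), z.re ≠ 0) : IsHurwitz (M 1) := by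
  by_contra hcon
  have hdet : Continuous fun p : ℝ × ℂ =>
      (p.2 • (1 : Matrix (Fin n) (Fin n) ℂ) - M p.1).det := by
    refine Continuous.matrix_det ?_
    exact (continuous_snd.smul continuous_const).sub (hM.comp continuous_fst)
  have hbd : Continuous fun t => ∑ i, ∑ j, ‖M t i j‖ := by
    refine continuous_finsetSum _ fun i _ => continuous_finsetSum _ fun j _ => ?_
    exact (hM.matrix_elem i j).norm
  obtain ⟨R, hR⟩ := (isCompact_Icc (a := (0 : ℝ)) (b := 1)).exists_bound_of_continuousOn
    hbd.continuousOn
  set K : Set (ℝ × ℂ) := (Set.Icc (0 : ℝ) 1 ×ˢ Metric.closedBall (0 : ℂ) R) ∩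
    ({p | 0 ≤ p.2.re} ∩ {p | (p.2 • (1 : Matrix (Fin n) (Fin n) ℂ) - M p.1).det = 0}) with hK
  have hKc : IsCompact K := by
    refine (isCompact_Icc.prod (isCompact_closedBall _ _)).inter_right ?_
    exact (isClosed_le continuous_const (Complex.continuous_re.comp continuous_snd)).inter
      (isClosed_eq hdet continuous_const)
  have hmem : ∀ t ∈ Set.Icc (0 : ℝ) 1, ∀ z ∈ spectrum ℂ (M t), 0 ≤ z.re → (t, z) ∈ K := by
    intro t ht z hz hre
    refine ⟨⟨ht, ?_⟩, hre, mem_spectrum_iff_det_eq_zero.1 hz⟩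
    rw [mem_closedBall_zero_iff]
    exact (norm_le_of_mem_spectrum hz).trans ((le_abs_self _).trans (hR t ht))
  simp only [IsHurwitz, not_forall, not_lt] at hcon
  obtain ⟨z₁, hz₁, hre₁⟩ := hcon
  -- `t'` is the first time at which some eigenvalue has nonnegative real part. That eigenvalue `z`
  -- is then strictly to the right of the axis, so slightly earlier matrices have an eigenvalue
  -- within `z.re` of it, still in the closed right half plane. This contradicts minimality.
  obtain ⟨t, ⟨⟨t', z⟩, htz, rfl⟩, hmin⟩ := (hKc.image continuous_fst).exists_isLeast
    ⟨1, (1, z₁), hmem 1 (by simp) z₁ hz₁ hre₁, rfl⟩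
  obtain ⟨⟨ht, -⟩, hre, hz⟩ := htz
  simp only [Set.mem_ofPred_eq] at ht hre hz
  have hzs : z ∈ spectrum ℂ (M t') := mem_spectrum_iff_det_eq_zero.2 hz
  have ht0 : 0 < t' := by
    refine lt_of_le_of_ne ht.1 fun h => ?_
    rw [← h] at hzs
    exact absurd (h0 z hzs) (not_lt.2 hre)
  have hzpos : 0 < z.re := lt_of_le_of_ne hre (Ne.symm (haxis t' ⟨ht0, ht.2⟩ z hzs))
  have hlim : Tendsto (fun s => ‖(z • (1 : Matrix (Fin n) (Fin n) ℂ) - M s).det‖) (𝓝 t') (𝓝 0) := by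
    have : Continuous fun s => ‖(z • (1 : Matrix (Fin n) (Fin n) ℂ) - M s).det‖ :=
      (hdet.comp (continuous_id.prodMk continuous_const)).norm
    simpa [hz] using this.tendsto t'
  have hev : ∀ᶠ s in 𝓝[<] t', ‖(z • (1 : Matrix (Fin n) (Fin n) ℂ) - M s).det‖ < z.re ^ n :=
    (hlim.eventually (gt_mem_nhds (by positivity))).filter_mono nhdsWithin_le_nhds
  obtain ⟨s, hs, hs0, hst⟩ := (hev.and (Ioo_mem_nhdsLT ht0)).exists
  obtain ⟨r, hr, hlt⟩ := exists_mem_spectrum_norm_sub_lt hzpos hs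
  have hrre : 0 ≤ r.re := by
    have := (le_abs_self _).trans (Complex.abs_re_le_norm (z - r))
    rw [Complex.sub_re] at this
    linarith
  have := hmin ⟨(s, r), hmem s ⟨hs0.le, hst.le.trans ht.2⟩ r hr hrre, rfl⟩
  exact absurd hst (not_lt.2 this)

end Spectrum

/-! ### From stability of the synchronization manifold to stability of the local loops. -/

namespace SyncNetwork

open Filter Topology MeasureTheory

variable {N n : ℕ} (net : SyncNetwork N n)

/-- The input vector, with complex entries. -/
def complexB : Fin n → ℂ := fun k => (net.B k : ℂ)

/-- The output vector, with complex entries. -/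
def complexC : Fin n → ℂ := fun k => (net.C k : ℂ)

/-- The state matrix `A - μ B C` of a subsystem under output feedback with gain `μ`. -/
def feedback (μ : ℂ) : Matrix (Fin n) (Fin n) ℂ :=
  net.complexA - μ • Matrix.vecMulVec net.complexB net.complexC

theorem transfer_eq (s : ℂ) : net.transfer s = net.complexC ⬝ᵥ
    ((s • (1 : Matrix (Fin n) (Fin n) ℂ) - net.complexA)⁻¹ *ᵥ net.complexB) := rfl

theorem feedback_mulVec (μ : ℂ) (x : Fin n → ℂ) : net.feedback μ *ᵥ x =
    net.complexA *ᵥ x - (μ * (net.complexC ⬝ᵥ x)) • net.complexB := by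
  rw [feedback, Matrix.sub_mulVec, Matrix.smul_mulVec, Matrix.vecMulVec_mulVec, mul_smul]
  simp

theorem vecMul_feedback (μ : ℂ) (x : Fin n → ℂ) : x ᵥ* net.feedback μ =
    x ᵥ* net.complexA - (μ * (x ⬝ᵥ net.complexB)) • net.complexC := by
  rw [feedback, Matrix.vecMul_sub, Matrix.vecMul_smul, Matrix.vecMul_vecMulVec, mul_smul]

theorem continuous_feedback : Continuous net.feedback :=
  continuous_const.sub (continuous_id.smul continuous_const)

theorem inWeight_nonneg (i : Fin N) : 0 ≤ net.inWeight i :=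
  Finset.sum_nonneg fun j _ => net.g_nonneg i j

theorem inWeight_le_maxInWeight (i : Fin N) : net.inWeight i ≤ net.maxInWeight :=
  le_ciSup (Set.finite_range _).bddAbove i

theorem exists_inWeight_eq_maxInWeight (h : 0 < net.maxInWeight) :
    ∃ i, net.inWeight i = net.maxInWeight := by
  rcases isEmpty_or_nonempty (Fin N) with hN | hN
  · simp [maxInWeight] at h
  · exact exists_eq_ciSup_of_finite

/-- `1 + μ T(iω) ≠ 0` for all `μ` in the open disc with diameter `[0, 2k]`, if
`Re T(iω) ≥ -1 / (2k)`. -/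
theorem one_add_mul_ne_zero {k : ℝ} {μ G : ℂ} (hμ : ‖μ - k‖ < k) (hG : -(1 / (2 * k)) ≤ G.re) :
    1 + μ * G ≠ 0 := by
  intro h
  have hk : 0 < k := (norm_nonneg _).trans_lt hμ
  have h1 : ‖μ - k‖ ^ 2 < k ^ 2 := pow_lt_pow_left₀ hμ (norm_nonneg _) two_ne_zero
  rw [← Complex.normSq_eq_norm_sq, Complex.normSq_apply] at h1
  have hre := congrArg Complex.re h
  have him := congrArg Complex.im h
  simp at h1 hre him
  -- Real part of `1 + μ G = 0` multiplied by the conjugate of `μ`.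
  have h2 : μ.re + (μ.re ^ 2 + μ.im ^ 2) * G.re = 0 := by
    linear_combination μ.re * hre + μ.im * him
  have h3 : μ.re ^ 2 + μ.im ^ 2 < 2 * k * μ.re := by nlinarith
  have h4 : -1 ≤ 2 * k * G.re := by
    rw [← neg_div, div_le_iff₀ (by positivity)] at hG
    linarith
  have h5 : 0 ≤ μ.re ^ 2 + μ.im ^ 2 := by positivity
  nlinarith [mul_nonneg h5 (by linarith : 0 ≤ 1 + 2 * k * G.re)]

/-- An imaginary eigenvalue `iω` of the loop that is not an eigenvalue of `A` forces `1 + μ T(iω) =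
0`. If it is an eigenvalue of `A`, or if `C x = 0`, the mode is uncontrollable or unobservable.
Feedback cannot move such a mode, so it would persist at the stabilizing gain `μ₀`. -/
theorem re_ne_zero_of_mem_spectrum_feedback {k : ℝ} {μ₀ μ : ℂ} (h₀ : IsHurwitz (net.feedback μ₀))
    (hμ : ‖μ - k‖ < k)
    (hfreq : ∀ ω : ℝ, (ω * Complex.I : ℂ) ∉ spectrum ℂ net.complexA →
      -(1 / (2 * k)) ≤ (net.transfer (ω * Complex.I)).re)
    {z : ℂ} (hz : z ∈ spectrum ℂ (net.feedback μ)) : z.re ≠ 0 := by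
  intro hre
  obtain ⟨ω, rfl⟩ : ∃ ω : ℝ, z = ω * Complex.I := ⟨z.im, by apply Complex.ext <;> simp [hre]⟩
  have hk : 0 < k := (norm_nonneg _).trans_lt hμ
  have hμ0 : μ ≠ 0 := by
    rintro rfl
    simp [abs_of_pos hk] at hμ
  have hcontra : ∀ x : Fin n → ℂ, x ≠ 0 → net.complexC ⬝ᵥ x = 0 →
      net.complexA *ᵥ x = (ω * Complex.I : ℂ) • x → False := by
    intro x hx0 hc hx
    refine absurd (h₀ (ω * Complex.I) (mem_spectrum_iff_exists_mulVec.2 ⟨x, hx0, ?_⟩)) ?_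
    · rw [feedback_mulVec, hc, hx]; simp
    · simp
  obtain ⟨x, hx0, hx⟩ := mem_spectrum_iff_exists_mulVec.1 hz
  rw [feedback_mulVec] at hx
  have hAx : net.complexA *ᵥ x =
      (ω * Complex.I : ℂ) • x + (μ * (net.complexC ⬝ᵥ x)) • net.complexB := by
    rw [← hx]; abel
  by_cases hc : net.complexC ⬝ᵥ x = 0
  · exact hcontra x hx0 hc (by rw [hAx, hc]; simp)
  by_cases hA : (ω * Complex.I : ℂ) ∈ spectrum ℂ net.complexA
  · obtain ⟨l, hl0, hl⟩ := mem_spectrum_iff_exists_vecMul.1 hA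
    have h1 : l ⬝ᵥ (net.complexA *ᵥ x) = (ω * Complex.I : ℂ) * (l ⬝ᵥ x) := by
      rw [Matrix.dotProduct_mulVec, hl, smul_dotProduct, smul_eq_mul]
    rw [hAx, dotProduct_add, dotProduct_smul, dotProduct_smul, smul_eq_mul, smul_eq_mul] at h1
    have h2 : μ * (net.complexC ⬝ᵥ x) * (l ⬝ᵥ net.complexB) = 0 := by linear_combination h1
    have h3 : l ⬝ᵥ net.complexB = 0 := by simpa [hμ0, hc] using h2
    refine absurd (h₀ (ω * Complex.I) (mem_spectrum_iff_exists_vecMul.2 ⟨l, hl0, ?_⟩)) ?_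
    · rw [vecMul_feedback, h3, hl]; simp
    · simp
  · obtain ⟨l, hl, hlb⟩ := exists_resolvent_functional net.complexB net.complexC hA
    have h1 := hl x
    rw [hAx, dotProduct_add, dotProduct_smul, dotProduct_smul, hlb, ← transfer_eq, smul_eq_mul,
      smul_eq_mul] at h1
    have h2 : (1 + μ * net.transfer (ω * Complex.I)) * (net.complexC ⬝ᵥ x) = 0 := by
      linear_combination h1
    exact (mul_ne_zero (one_add_mul_ne_zero hμ (hfreq ω hA)) hc) h2

/-- Under the frequency bound, a stabilizing feedback gain in the closed disc with diameter
`[0, 2k]` makes all gains in the open disc stabilizing. -/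
theorem isHurwitz_feedback_of_mem_ball {k : ℝ} {μ₀ μ : ℂ} (h₀ : IsHurwitz (net.feedback μ₀))
    (hμ₀ : ‖μ₀ - k‖ ≤ k) (hμ : ‖μ - k‖ < k)
    (hfreq : ∀ ω : ℝ, (ω * Complex.I : ℂ) ∉ spectrum ℂ net.complexA →
      -(1 / (2 * k)) ≤ (net.transfer (ω * Complex.I)).re) :
    IsHurwitz (net.feedback μ) := by
  -- The path is the segment from `μ₀` to `μ`; it lies in the open disc for `t > 0`, even when `μ₀`
  -- is on the boundary circle.
  have h := IsHurwitz.of_path (M := fun t : ℝ => net.feedback ((1 - t) * μ₀ + t * μ))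
    (net.continuous_feedback.comp (by fun_prop)) (by simpa using h₀) (fun t ht z hz => by
      refine net.re_ne_zero_of_mem_spectrum_feedback h₀ ?_ hfreq hz
      have e : (1 - t) * μ₀ + t * μ - k = ((1 - t : ℝ) : ℂ) * (μ₀ - k) + (t : ℂ) * (μ - k) := by
        push_cast; ring
      rw [e]
      refine (norm_add_le _ _).trans_lt ?_
      rw [norm_mul, norm_mul, Complex.norm_real, Complex.norm_real,
        Real.norm_of_nonneg (sub_nonneg.2 ht.2), Real.norm_of_nonneg ht.1.le]
      nlinarith [ht.1, ht.2])
  simpa using h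

/-- The weighted graph Laplacian, with complex entries. -/
def laplacian : Matrix (Fin N) (Fin N) ℂ :=
  Matrix.of fun i j => if j = i then (net.inWeight i : ℂ) else -(net.g i j : ℂ)

theorem laplacian_mulVec (y : Fin N → ℂ) (i : Fin N) :
    (net.laplacian *ᵥ y) i = -∑ j with j ≠ i, (net.g i j : ℂ) * (y j - y i) := by
  have h1 : (net.laplacian *ᵥ y) i = ∑ j, (if j = i then (net.inWeight i : ℂ) * y i
      else -(net.g i j : ℂ) * y j) := by
    rw [Matrix.mulVec, dotProduct]
    refine Finset.sum_congr rfl fun j _ => ?_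
    simp only [laplacian, Matrix.of_apply]
    split_ifs with h
    · rw [h]
    · rfl
  rw [h1, Finset.sum_ite]
  simp only [Finset.filter_eq', Finset.mem_univ, if_true, Finset.sum_singleton]
  simp only [inWeight, mul_sub, Finset.sum_sub_distrib, ← Finset.sum_mul, neg_mul,
    Finset.sum_neg_distrib, Complex.ofReal_sum]
  ring

theorem laplacian_mulVec_one : net.laplacian *ᵥ (fun _ => 1) = 0 := by
  ext i
  rw [laplacian_mulVec]; simp

/-- A left eigenvector of the Laplacian that is orthogonal to the constant vector. -/
theorem exists_left_eigenvector_laplacian {i j : Fin N} (hij : i ≠ j) :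
    ∃ (v : Fin N → ℂ) (z : ℂ), v ≠ 0 ∧ ∑ i, v i = 0 ∧ v ᵥ* net.laplacian = z • v := by
  set W : Submodule ℂ (Fin N → ℂ) :=
    LinearMap.ker (∑ i, LinearMap.proj i : (Fin N → ℂ) →ₗ[ℂ] ℂ) with hW
  have hmem : ∀ v : Fin N → ℂ, v ∈ W ↔ ∑ i, v i = 0 := fun v => by simp [hW]
  -- The sum-zero vectors are invariant under `v ↦ v L` because `L` kills the constant vector, so
  -- this nonzero space contains an eigenvector.
  have hinv : ∀ v ∈ W, net.laplacian.vecMulLinear v ∈ W := by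
    intro v _
    rw [hmem, Matrix.vecMulLinear_apply]
    have : (v ᵥ* net.laplacian) ⬝ᵥ (fun _ => (1 : ℂ)) = 0 := by
      rw [← Matrix.dotProduct_mulVec, laplacian_mulVec_one, dotProduct_zero]
    simpa [dotProduct] using this
  have hnt : Nontrivial W := by
    refine ⟨⟨Pi.single i 1 - Pi.single j 1, ?_⟩, 0, fun h => ?_⟩
    · rw [hmem]; simp [Finset.sum_sub_distrib]
    · have := congrFun (congrArg Subtype.val h) i
      simp [hij] at this
  obtain ⟨z, hz⟩ := Module.End.exists_eigenvalue (net.laplacian.vecMulLinear.restrict hinv)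
  obtain ⟨v, hv⟩ := hz.exists_hasEigenvector
  refine ⟨v, z, fun h => hv.2 (Subtype.ext h), (hmem _).1 v.2, ?_⟩
  exact congrArg Subtype.val hv.apply_eq_smul

/-- Each Gershgorin disc of the Laplacian has the in-weight as both centre and radius. All of these
discs touch `0` and are nested, so the largest contains the spectrum. -/
theorem norm_sub_maxInWeight_le {z : ℂ} (hz : z ∈ spectrum ℂ net.laplacian) :
    ‖z - net.maxInWeight‖ ≤ net.maxInWeight := by
  rw [← Matrix.spectrum_toLin', ← Module.End.hasEigenvalue_iff_mem_spectrum] at hz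
  obtain ⟨i, hi⟩ := eigenvalue_mem_ball hz
  have hsum : ∑ j ∈ Finset.univ.erase i, ‖net.laplacian i j‖ = net.inWeight i := by
    rw [inWeight]
    refine Finset.sum_congr (by ext; simp) fun j hj => ?_
    have : j ≠ i := by simpa using hj
    simp [laplacian, this, abs_of_nonneg (net.g_nonneg i j)]
  rw [hsum, mem_closedBall_iff_norm] at hi
  have hd : net.laplacian i i = net.inWeight i := by simp [laplacian]
  rw [hd] at hi
  have h2 := net.inWeight_le_maxInWeight i
  calc ‖z - net.maxInWeight‖
      = ‖(z - net.inWeight i) + ((net.inWeight i - net.maxInWeight : ℝ) : ℂ)‖ := by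
        congr 1; push_cast; ring
    _ ≤ net.inWeight i + (net.maxInWeight - net.inWeight i) := by
        refine (norm_add_le _ _).trans (add_le_add hi ?_)
        rw [Complex.norm_real, Real.norm_of_nonpos (by linarith), neg_sub]
    _ = _ := by ring

/-- The velocity field of the undisturbed network as a linear map. -/
def velocityLinear : (Fin N → Fin n → ℝ) →ₗ[ℝ] (Fin N → Fin n → ℝ) where
  toFun x := net.velocity 0 x
  map_add' x y := by
    ext i k
    simp only [velocity, output, Pi.add_apply, Pi.zero_apply, dotProduct_add, Matrix.mulVec_add,
      Pi.smul_apply, smul_eq_mul, add_zero]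
    have : ∀ j, net.g i j * (net.C ⬝ᵥ x j + net.C ⬝ᵥ y j - (net.C ⬝ᵥ x i + net.C ⬝ᵥ y i)) =
      net.g i j * (net.C ⬝ᵥ x j - net.C ⬝ᵥ x i) + net.g i j * (net.C ⬝ᵥ y j - net.C ⬝ᵥ y i) :=
      fun j => by ring
    simp only [this, Finset.sum_add_distrib]
    ring
  map_smul' a x := by
    ext i k
    simp only [velocity, output, Pi.smul_apply, Pi.zero_apply, dotProduct_smul, Matrix.mulVec_smul,
      Pi.add_apply, smul_eq_mul, add_zero, RingHom.id_apply]
    have : ∀ j, net.g i j * (a * (net.C ⬝ᵥ x j) - a * (net.C ⬝ᵥ x i)) =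
      a * (net.g i j * (net.C ⬝ᵥ x j - net.C ⬝ᵥ x i)) := fun j => by ring
    simp only [this, ← Finset.mul_sum]
    ring

theorem exists_trajectory (x₀ : Fin N → Fin n → ℝ) :
    ∃ x : ℝ → Fin N → Fin n → ℝ, x 0 = x₀ ∧ net.IsTrajectory 0 x ∧
      ∀ t, HasDerivAt x (net.velocity 0 (x t)) t := by
  set V : (Fin N → Fin n → ℝ) →L[ℝ] (Fin N → Fin n → ℝ) :=
    LinearMap.toContinuousLinearMap net.velocityLinear with hV
  have hVx : ∀ x, V x = net.velocity 0 x := fun x => rfl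
  set x : ℝ → Fin N → Fin n → ℝ := fun t => NormedSpace.exp (t • V) x₀ with hx
  have hd : ∀ t, HasDerivAt x (net.velocity 0 (x t)) t := by
    intro t
    rw [← hVx]
    have h := (hasDerivAt_exp_smul_const' (𝕂 := ℝ) V t).clm_apply (hasDerivAt_const t x₀)
    simpa using h
  have hc : Continuous x := continuous_iff_continuousAt.2 fun t => (hd t).continuousAt
  refine ⟨x, by simp [hx], ⟨hc.continuousOn, fun t _ i => ?_⟩, hd⟩
  have hci : Continuous fun τ => net.velocity 0 (x τ) i :=
    (continuous_apply i).comp (V.continuous.comp hc)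
  have := intervalIntegral.integral_eq_sub_of_hasDerivAt (a := 0) (b := t)
    (fun τ _ => hasDerivAt_pi.1 (hd τ) i) (hci.intervalIntegrable 0 t)
  have h2 : ∫ τ in (0 : ℝ)..t, net.velocity ((0 : ℝ → Fin N → ℝ) τ) (x τ) i = x t i - x 0 i := this
  rw [h2]; abel

/-- The linear functional on network states given by a left eigenvector `v` of the Laplacian and a
left eigenvector `l` of the corresponding mode. -/
def mode (v : Fin N → ℂ) (l : Fin n → ℂ) (x : Fin N → Fin n → ℝ) : ℂ :=
  ∑ i, v i * (l ⬝ᵥ fun k => (x i k : ℂ))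

/-- The left eigenvector `v` decouples the network: `∑ v_i x_i` evolves by `A - α a B C`, and `l`
extracts one scalar mode of that matrix. -/
theorem mode_velocity {v : Fin N → ℂ} {l : Fin n → ℂ} {a z : ℂ}
    (hv : v ᵥ* net.laplacian = a • v) (hl : l ᵥ* net.feedback (net.α * a) = z • l)
    (x : Fin N → Fin n → ℝ) : mode v l (net.velocity 0 x) = z * mode v l x := by
  set X : Fin N → Fin n → ℂ := fun i k => (x i k : ℂ) with hX
  set y : Fin N → ℂ := fun i => net.complexC ⬝ᵥ X i with hy
  have hyr : ∀ i, y i = (net.output (x i) : ℂ) := by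
    intro i
    simp [hy, hX, output, complexC, dotProduct]
  have h1 : ∀ i, (fun k => ((net.velocity 0 x i k : ℝ) : ℂ)) =
      net.complexA *ᵥ X i - (net.α * (net.laplacian *ᵥ y) i) • net.complexB := by
    intro i
    ext k
    rw [laplacian_mulVec]
    simp only [velocity, hyr, Pi.add_apply, Pi.zero_apply, Pi.smul_apply, smul_eq_mul, add_zero,
      Pi.sub_apply, complexB]
    push_cast
    have : ((net.A *ᵥ x i) k : ℂ) = (net.complexA *ᵥ X i) k := by
      simp [Matrix.mulVec, dotProduct, complexA, hX]
    rw [this]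
    ring
  have h2 : ∀ i, l ⬝ᵥ (net.complexA *ᵥ X i) =
      z * (l ⬝ᵥ X i) + net.α * a * (l ⬝ᵥ net.complexB) * y i := by
    intro i
    rw [vecMul_feedback, sub_eq_iff_eq_add] at hl
    rw [Matrix.dotProduct_mulVec, hl, add_dotProduct, smul_dotProduct, smul_dotProduct]
    rfl
  have h3 : ∑ i, v i * (net.laplacian *ᵥ y) i = a * ∑ i, v i * y i := by
    have : v ⬝ᵥ (net.laplacian *ᵥ y) = a * (v ⬝ᵥ y) := by
      rw [Matrix.dotProduct_mulVec, hv, smul_dotProduct, smul_eq_mul]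
    exact this
  have h4 : mode v l (net.velocity 0 x) = ∑ i, (z * (v i * (l ⬝ᵥ X i)) +
      net.α * a * (l ⬝ᵥ net.complexB) * (v i * y i) -
      net.α * (l ⬝ᵥ net.complexB) * (v i * (net.laplacian *ᵥ y) i)) := by
    refine Finset.sum_congr rfl fun i _ => ?_
    rw [h1, dotProduct_sub, dotProduct_smul, h2, smul_eq_mul]
    ring
  rw [h4, Finset.sum_sub_distrib, Finset.sum_add_distrib, ← Finset.mul_sum, ← Finset.mul_sum,
    ← Finset.mul_sum, h3, mode]
  ring

/-- Weights of sum zero make the functional vanish on the manifold, so attraction to the manifold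
forces the mode to zero. -/
theorem norm_mode_le_infDist {v : Fin N → ℂ} (hv : ∑ i, v i = 0) (l : Fin n → ℂ)
    (x : Fin N → Fin n → ℝ) :
    ‖mode v l x‖ ≤ ((∑ i, ‖v i‖) * ∑ k, ‖l k‖) * Metric.infDist x (syncManifold N n) := by
  set K := (∑ i, ‖v i‖) * ∑ k, ‖l k‖ with hK
  have hK0 : 0 ≤ K := by positivity
  have hne : (syncManifold N n).Nonempty := ⟨0, fun _ _ => rfl⟩
  have key : ∀ m ∈ syncManifold N n, ‖mode v l x‖ ≤ K * dist x m := by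
    intro m hm
    have hm0 : mode v l m = 0 := by
      rcases isEmpty_or_nonempty (Fin N) with h | ⟨⟨i₀⟩⟩
      · simp [mode]
      · have : mode v l m = (∑ i, v i) * (l ⬝ᵥ fun k => (m i₀ k : ℂ)) := by
          rw [Finset.sum_mul]
          exact Finset.sum_congr rfl fun i _ => by rw [hm i i₀]
        rw [this, hv, zero_mul]
    have hsub : mode v l x = ∑ i, v i * (l ⬝ᵥ fun k => ((x i k - m i k : ℝ) : ℂ)) := by
      rw [← sub_zero (mode v l x), ← hm0, mode, mode, ← Finset.sum_sub_distrib]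
      refine Finset.sum_congr rfl fun i _ => ?_
      rw [← mul_sub, ← dotProduct_sub]
      congr 2; ext k; simp
    rw [hsub, hK, mul_assoc, Finset.sum_mul]
    refine (norm_sum_le _ _).trans (Finset.sum_le_sum fun i _ => ?_)
    rw [norm_mul]
    refine mul_le_mul_of_nonneg_left ((norm_dotProduct_le _ _).trans ?_) (norm_nonneg _)
    refine mul_le_mul_of_nonneg_left ?_ (by positivity)
    refine (pi_norm_le_iff_of_nonneg dist_nonneg).2 fun k => ?_
    rw [Complex.norm_real, dist_eq_norm]
    exact (norm_le_pi_norm ((x - m) i) k).trans (norm_le_pi_norm (x - m) i)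
  rcases hK0.eq_or_lt with h0 | hpos
  · obtain ⟨m, hm⟩ := hne
    have := key m hm
    rw [← h0] at this ⊢
    simpa using this
  · rw [mul_comm, ← div_le_iff₀ hpos]
    refine (Metric.le_infDist hne).2 fun m hm => ?_
    rw [div_le_iff₀ hpos, mul_comm]
    exact key m hm

/-- Asymptotic stability of the synchronization manifold makes all transversal modes stable. -/
theorem isHurwitz_feedback_of_asympStable (hs : net.SyncManifoldAsympStable) {v : Fin N → ℂ}
    {a : ℂ} (hv0 : v ≠ 0) (hv1 : ∑ i, v i = 0) (hv : v ᵥ* net.laplacian = a • v) :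
    IsHurwitz (net.feedback (net.α * a)) := by
  intro z hz
  by_contra hre
  obtain ⟨l, hl0, hl⟩ := mem_spectrum_iff_exists_vecMul.1 hz
  obtain ⟨i, hi⟩ := Function.ne_iff.1 hv0
  obtain ⟨k, hk⟩ := Function.ne_iff.1 hl0
  obtain ⟨δ, hδ, hattr⟩ := hs.2
  -- One coordinate is perturbed, at a node and component where `v` and `l` do not vanish. The mode
  -- starts nonzero, is multiplied by `exp (z t)`, and cannot tend to zero if `z.re ≥ 0`.
  obtain ⟨x, hx0, hx, hxd⟩ := net.exists_trajectory (Pi.single i (Pi.single k (δ / 2)))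
  have hdist : Metric.infDist (x 0) (syncManifold N n) < δ := by
    refine (Metric.infDist_le_dist_of_mem
      (show (0 : Fin N → Fin n → ℝ) ∈ syncManifold N n from fun _ _ => rfl)).trans_lt ?_
    rw [hx0, dist_zero_right, Pi.norm_single, Pi.norm_single, Real.norm_of_nonneg (by positivity)]
    linarith
  have hlim := hattr x hx hdist
  have hm0 : mode v l (x 0) = v i * l k * (δ / 2 : ℝ) := by
    rw [hx0, mode, Finset.sum_eq_single i]
    · rw [dotProduct, Finset.sum_eq_single k]
      · simp [mul_assoc]
      · intro j _ hj; simp [hj]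
      · simp
    · intro j _ hj; simp [hj, dotProduct]
    · simp
  have hm0' : mode v l (x 0) ≠ 0 := by
    rw [hm0]
    refine mul_ne_zero (mul_ne_zero hi hk) ?_
    exact_mod_cast (by positivity : δ / 2 ≠ 0)
  have hd : ∀ t, HasDerivAt (fun t => mode v l (x t)) (z * mode v l (x t)) t := by
    intro t
    rw [← net.mode_velocity hv hl]
    have h1 : ∀ i, HasDerivAt (fun t => fun k => ((x t i k : ℝ) : ℂ))
        (fun k => ((net.velocity 0 (x t) i k : ℝ) : ℂ)) t := fun i =>
      hasDerivAt_pi.2 fun k => (hasDerivAt_pi.1 (hasDerivAt_pi.1 (hxd t) i) k).ofReal_comp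
    exact HasDerivAt.fun_sum fun i _ => ((h1 i).dotProduct_const l).const_mul (v i)
  have hexp : ∀ t : ℝ, HasDerivAt (fun t : ℝ => Complex.exp (-z * t))
      (Complex.exp (-z * t) * -z) t := by
    intro t
    have := ((hasDerivAt_id (t : ℂ)).const_mul (-z)).cexp.comp_ofReal
    simpa using this
  have hconst : ∀ t : ℝ, Complex.exp (-z * t) * mode v l (x t) = mode v l (x 0) := by
    intro t
    have h : ∀ t : ℝ, HasDerivAt (fun t : ℝ => Complex.exp (-z * t) * mode v l (x t)) 0 t :=
      fun t => ((hexp t).mul (hd t)).congr_deriv (by ring)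
    have := is_const_of_deriv_eq_zero (fun t => (h t).differentiableAt) (fun t => (h t).deriv) t 0
    simpa using this
  have hmlim : Tendsto (fun t => mode v l (x t)) atTop (𝓝 0) := by
    rw [tendsto_zero_iff_norm_tendsto_zero]
    refine squeeze_zero (fun t => norm_nonneg _) (fun t => norm_mode_le_infDist hv1 l (x t)) ?_
    simpa using hlim.const_mul ((∑ i, ‖v i‖) * ∑ k, ‖l k‖)
  have hle : ∀ t : ℝ, 0 ≤ t → ‖mode v l (x 0)‖ ≤ ‖mode v l (x t)‖ := by
    intro t ht
    rw [← hconst t, norm_mul, Complex.norm_exp]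
    refine mul_le_of_le_one_left (norm_nonneg _) (Real.exp_le_one_iff.2 ?_)
    have : 0 ≤ z.re * t := mul_nonneg (not_lt.1 hre) ht
    simpa using this
  have hle0 : ‖mode v l (x 0)‖ ≤ 0 := by
    have h := hmlim.norm
    rw [norm_zero] at h
    exact ge_of_tendsto h ((eventually_ge_atTop 0).mono fun t ht => hle t ht)
  exact hm0' (norm_le_zero_iff.1 hle0)

theorem isHurwitz_feedback_gain (hα : 0 < net.α) (hs : net.SyncManifoldAsympStable)
    (hfreq : ∀ ω : ℝ, (ω * Complex.I : ℂ) ∉ spectrum ℂ net.complexA → net.FrequencyBound ω)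
    {i : Fin N} (hi : 0 < net.inWeight i) : IsHurwitz (net.feedback (net.gain i)) := by
  obtain ⟨j, hj⟩ : ∃ j, j ≠ i := by
    by_contra! h
    simp [inWeight, h] at hi
  obtain ⟨v, a, hv0, hv1, hv⟩ := net.exists_left_eigenvector_laplacian hj
  have ha := net.norm_sub_maxInWeight_le (mem_spectrum_iff_exists_vecMul.2 ⟨v, hv0, hv⟩)
  have hle := net.inWeight_le_maxInWeight i
  have hmax : 0 < net.maxInWeight := hi.trans_le hle
  refine net.isHurwitz_feedback_of_mem_ball (k := net.α * net.maxInWeight)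
    (net.isHurwitz_feedback_of_asympStable hs hv0 hv1 hv) ?_ ?_ fun ω hω => ?_
  · rw [Complex.ofReal_mul, ← mul_sub, norm_mul, Complex.norm_real, Real.norm_of_nonneg hα.le]
    exact mul_le_mul_of_nonneg_left ha hα.le
  · rw [gain, ← Complex.ofReal_sub, Complex.norm_real, Real.norm_eq_abs, abs_lt, ← mul_sub]
    constructor <;> nlinarith [mul_pos hα hi, mul_pos hα hmax, mul_le_mul_of_nonneg_left hle hα.le]
  · rw [← mul_assoc]
    exact hfreq ω hω hmax

end SyncNetwork

/-! ### Local energy inequality and the maximum principle beyond a cutset. -/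

namespace SyncNetwork

open Filter Topology MeasureTheory

variable {N n : ℕ} (net : SyncNetwork N n)

theorem norm_mul_le_norm_one_add_mul_iff (k : ℝ) (G : ℂ) :
    ‖k * G‖ ≤ ‖1 + k * G‖ ↔ 0 ≤ 1 + 2 * (k * G.re) := by
  rw [← sq_le_sq₀ (norm_nonneg _) (norm_nonneg _), ← Complex.normSq_eq_norm_sq,
    ← Complex.normSq_eq_norm_sq, Complex.normSq_apply, Complex.normSq_apply]
  simp
  constructor <;> intro h <;> nlinarith

theorem one_add_mul_ne_zero_and_norm_div_le_iff (k : ℝ) (G : ℂ) :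
    (1 + k * G ≠ 0 ∧ ‖k * G / (1 + k * G)‖ ≤ 1) ↔ 0 ≤ 1 + 2 * (k * G.re) := by
  rw [← norm_mul_le_norm_one_add_mul_iff]
  constructor
  · rintro ⟨h0, h⟩
    rwa [norm_div, div_le_one (norm_pos_iff.2 h0)] at h
  · intro h
    have h0 : 1 + k * G ≠ 0 := by
      intro h0
      rw [h0, norm_zero, norm_le_zero_iff] at h
      rw [h, add_zero] at h0
      exact one_ne_zero h0
    exact ⟨h0, by rwa [norm_div, div_le_one (norm_pos_iff.2 h0)]⟩

theorem frequencyBound_iff_localRequirement (hα : 0 < net.α) (ω : ℝ) :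
    net.FrequencyBound ω ↔ net.LocalRequirement ω := by
  set r := (net.transfer (ω * Complex.I)).re with hr
  have key : ∀ m : ℝ, 0 < m → (-(1 / (2 * net.α * m)) ≤ r ↔ 0 ≤ 1 + 2 * (net.α * m * r)) := by
    intro m hm
    rw [← neg_div, div_le_iff₀ (by positivity)]
    constructor <;> intro h <;> linarith
  have hloc : net.LocalRequirement ω ↔ ∀ i, 0 ≤ 1 + 2 * (net.gain i * r) :=
    forall_congr' fun i => one_add_mul_ne_zero_and_norm_div_le_iff _ _
  rw [hloc]
  constructor
  · intro h i
    rcases (net.inWeight_nonneg i).eq_or_lt with h0 | hpos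
    · simp [gain, ← h0]
    have hle := net.inWeight_le_maxInWeight i
    have h1 := (key _ (hpos.trans_le hle)).1 (h (hpos.trans_le hle))
    rw [gain]
    -- The requirement is automatic for `r ≥ 0`; for `r ≤ 0` it is strictest at the largest gain.
    rcases le_total 0 r with hr0 | hr0
    · positivity
    · have := mul_le_mul_of_nonpos_right (mul_le_mul_of_nonneg_left hle hα.le) hr0
      linarith
  · intro h hmax
    obtain ⟨i, hi⟩ := net.exists_inWeight_eq_maxInWeight hmax
    have := h i
    rw [gain, hi] at this
    exact (key _ hmax).2 this

theorem energy_nonneg (x : ℝ → Fin N → Fin n → ℝ) {T : ℝ} (hT : 0 ≤ T) (i : Fin N) :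
    0 ≤ net.energy x T i :=
  intervalIntegral.integral_nonneg hT fun _ _ => sq_nonneg _

theorem continuous_output : Continuous net.output := by
  unfold output dotProduct
  fun_prop

theorem continuous_velocity_zero : Continuous (net.velocity 0) :=
  (LinearMap.toContinuousLinearMap net.velocityLinear).continuous

variable {net}

theorem IsTrajectory.continuousOn_output {u : ℝ → Fin N → ℝ} {x : ℝ → Fin N → Fin n → ℝ}
    (hx : net.IsTrajectory u x) (i : Fin N) :
    ContinuousOn (fun t => net.output (x t i)) (Set.Ici 0) :=
  net.continuous_output.comp_continuousOn ((continuous_apply i).comp_continuousOn hx.1)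

/-- The state of a subsystem without external input extends to a differentiable function. -/
theorem IsTrajectory.exists_hasDerivAt {u : ℝ → Fin N → ℝ} {x : ℝ → Fin N → Fin n → ℝ}
    (hx : net.IsTrajectory u x) {i : Fin N} (hi : ∀ t, u t i = 0) :
    ∃ X : ℝ → Fin n → ℝ, (∀ t, 0 ≤ t → X t = x t i) ∧
      ∀ t, 0 ≤ t → HasDerivAt X (net.velocity 0 (x t) i) t := by
  have hv : ∀ t, net.velocity (u t) (x t) i = net.velocity 0 (x t) i := fun t => by
    simp [velocity, hi]
  -- Freezing the velocity at its value at `0` for negative times gives a two-sided derivative also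
  -- at `t = 0`.
  set h : ℝ → Fin n → ℝ := fun t => net.velocity 0 (x (max t 0)) i with hh
  have hhc : Continuous h := by
    have : Continuous fun t : ℝ => x (max t 0) :=
      hx.1.comp_continuous (by fun_prop) fun t => le_max_right t 0
    exact (continuous_apply i).comp (net.continuous_velocity_zero.comp this)
  refine ⟨fun t => x 0 i + ∫ τ in (0 : ℝ)..t, h τ, fun t ht => ?_, fun t ht => ?_⟩
  · rw [hx.2 t ht i]
    have : Set.EqOn (fun τ => net.velocity (u τ) (x τ) i) h (Set.uIcc 0 t) := fun τ hτ => by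
      rw [Set.uIcc_of_le ht] at hτ
      simp only [hh, max_eq_left hτ.1, hv]
    rw [intervalIntegral.integral_congr this]
  · have h1 : HasDerivAt (fun t => ∫ τ in (0 : ℝ)..t, h τ) (h t) t :=
      intervalIntegral.integral_hasDerivAt_right (hhc.intervalIntegrable 0 t)
        hhc.stronglyMeasurable.stronglyMeasurableAtFilter hhc.continuousAt
    have h2 := h1.const_add (x 0 i)
    simp only [hh, max_eq_left ht] at h2
    exact h2

theorem velocity_zero_eq {x : Fin N → Fin n → ℝ} {i : Fin N} (hi : 0 < net.inWeight i) :
    net.velocity 0 x i = net.A *ᵥ x i + (net.gain i *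
      ((∑ j with j ≠ i, net.g i j / net.inWeight i * net.output (x j)) - net.output (x i))) •
        net.B := by
  have h1 : ∑ j with j ≠ i, net.g i j / net.inWeight i * net.output (x j) =
      (∑ j with j ≠ i, net.g i j * net.output (x j)) / net.inWeight i := by
    rw [Finset.sum_div]
    exact Finset.sum_congr rfl fun j _ => by ring
  rw [velocity, h1]
  congr 2
  simp only [mul_sub, Finset.sum_sub_distrib, ← Finset.sum_mul, Pi.zero_apply, add_zero]
  rw [gain, ← inWeight]
  field_simp

/-- Without external input, the energy of a stable subsystem whose complementary sensitivity
function is bounded by `1` is at most the weighted mean of the energies of its in-neighbours. -/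
theorem inWeight_mul_energy_le (hloc : ∀ ω : ℝ,
      (ω * Complex.I : ℂ) ∉ spectrum ℂ net.complexA → net.LocalRequirement ω)
    {u : ℝ → Fin N → ℝ} {x : ℝ → Fin N → Fin n → ℝ} (hx : net.IsTrajectory u x) {i : Fin N}
    (hui : ∀ t, u t i = 0) (hx0 : x 0 i = 0) (hi : 0 < net.inWeight i)
    (hstab : IsHurwitz (net.feedback (net.gain i))) {T : ℝ} (hT : 0 ≤ T) :
    net.inWeight i * net.energy x T i ≤ ∑ j with j ≠ i, net.g i j * net.energy x T j := by
  obtain ⟨X, hX, hXd⟩ := hx.exists_hasDerivAt hui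
  set p : Fin N → ℝ := fun j => net.g i j / net.inWeight i with hp
  have hp0 : ∀ j, 0 ≤ p j := fun j => div_nonneg (net.g_nonneg i j) hi.le
  have hp1 : ∑ j with j ≠ i, p j = 1 := by
    rw [hp, ← Finset.sum_div, ← inWeight, div_self hi.ne']
  set v : ℝ → ℝ := fun t => ∑ j with j ≠ i, p j * net.output (x t j) with hv
  have hcont : ∀ j, ContinuousOn (fun t => net.output (x t j)) (Set.Icc 0 T) := fun j =>
    (hx.continuousOn_output j).mono Set.Icc_subset_Ici_self
  have hvc : ContinuousOn v (Set.Icc 0 T) :=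
    continuousOn_finsetSum _ fun j _ => (hcont j).const_smul (p j)
  have hout : ∀ w : Fin n → ℝ, net.complexC ⬝ᵥ (fun k => (w k : ℂ)) = (net.output w : ℂ) := by
    intro w; simp [output, complexC, dotProduct]
  have hgain := integral_output_sq_le (A := net.complexA) (b := net.complexB) (c := net.complexC)
    (k := (net.gain i : ℂ)) (G := net.transfer) (T := T) (v := fun t => (v t : ℂ))
    (Z := fun t k => (X t k : ℂ))
    (fun z w hw h => hstab z (mem_spectrum_iff_exists_mulVec.2 ⟨w, hw, by
      rw [feedback_mulVec]; exact h⟩))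
    (funext net.transfer_eq) (fun ω hω => hloc ω hω i) hT
    (Complex.continuous_ofReal.comp_continuousOn hvc)
    (by ext k; simp [hX 0 le_rfl, hx0])
    (fun t ht => by
      refine hasDerivAt_pi.2 fun k => ?_
      have h := (hasDerivAt_pi.1 (hXd t ht.1) k).ofReal_comp
      refine h.congr_deriv ?_
      rw [velocity_zero_eq hi, hout, hX t ht.1]
      simp only [Pi.add_apply, Pi.smul_apply, smul_eq_mul, hv, hp, complexB]
      push_cast
      congr 1
      simp [Matrix.mulVec, dotProduct, complexA])
  have h1 : ∫ t in (0 : ℝ)..T, ‖net.complexC ⬝ᵥ (fun k => (X t k : ℂ))‖ ^ 2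
      = net.energy x T i := by
    refine intervalIntegral.integral_congr fun t ht => ?_
    rw [Set.uIcc_of_le hT] at ht
    simp only [hout, hX t ht.1, Complex.norm_real, Real.norm_eq_abs, sq_abs]
  have h2 : ∫ t in (0 : ℝ)..T, ‖(v t : ℂ)‖ ^ 2 = ∫ t in (0 : ℝ)..T, v t ^ 2 := by
    simp only [Complex.norm_real, Real.norm_eq_abs, sq_abs]
  rw [h1, h2] at hgain
  have hint : ∀ j, IntervalIntegrable (fun t => net.output (x t j) ^ 2) volume 0 T := by
    intro j
    apply ContinuousOn.intervalIntegrable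
    rw [Set.uIcc_of_le hT]
    exact (hcont j).pow 2
  have h3 : ∫ t in (0 : ℝ)..T, v t ^ 2 ≤ ∑ j with j ≠ i, p j * net.energy x T j := by
    simp only [energy, ← intervalIntegral.integral_const_mul]
    rw [← intervalIntegral.integral_finsetSum fun j _ => (hint j).const_mul (p j)]
    refine intervalIntegral.integral_mono_on hT ?_ ?_ fun t _ => ?_
    · apply ContinuousOn.intervalIntegrable
      rw [Set.uIcc_of_le hT]
      exact hvc.pow 2
    · apply ContinuousOn.intervalIntegrable
      rw [Set.uIcc_of_le hT]
      exact continuousOn_finsetSum _ fun j _ => ((hcont j).pow 2).const_smul (p j)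
    -- Jensen's inequality for the square, pointwise in time.
    · exact Real.pow_arith_mean_le_arith_mean_pow_of_even _ _ _ (fun j _ => hp0 j) hp1 even_two
  have h4 : net.inWeight i * ∑ j with j ≠ i, p j * net.energy x T j =
      ∑ j with j ≠ i, net.g i j * net.energy x T j := by
    rw [Finset.mul_sum]
    refine Finset.sum_congr rfl fun j _ => ?_
    simp only [hp]
    field_simp
  rw [← h4]
  exact mul_le_mul_of_nonneg_left (hgain.trans h3) hi.le

/-- A set of vertices at rest without external input and without incoming edges stays at rest. -/
theorem IsTrajectory.eq_zero_of_closed {u : ℝ → Fin N → ℝ} {x : ℝ → Fin N → Fin n → ℝ}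
    (hx : net.IsTrajectory u x) {S : Finset (Fin N)} (hu : ∀ i ∈ S, ∀ t, u t i = 0)
    (hx0 : ∀ i ∈ S, x 0 i = 0) (hS : ∀ i ∈ S, ∀ j, j ≠ i → j ∉ S → net.g i j = 0)
    {i : Fin N} (hi : i ∈ S) {t : ℝ} (ht : 0 ≤ t) : x t i = 0 := by
  set V : (Fin N → Fin n → ℝ) →L[ℝ] (Fin N → Fin n → ℝ) :=
    LinearMap.toContinuousLinearMap net.velocityLinear with hV
  have hVx : ∀ x, V x = net.velocity 0 x := fun x => rfl
  -- States outside `S` are replaced by zero. As no edge enters `S`, the velocities inside `S` do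
  -- not notice, so `‖w'‖ ≤ ‖V‖ ‖w‖` and Grönwall gives `w = 0`.
  set w : ℝ → Fin N → Fin n → ℝ := fun t i => if i ∈ S then x t i else 0 with hw
  set w' : ℝ → Fin N → Fin n → ℝ := fun t i => if i ∈ S then V (w t) i else 0 with hw'
  have hvel : ∀ t, ∀ i ∈ S, net.velocity 0 (x t) i = V (w t) i := by
    intro t i hi
    rw [hVx, velocity, velocity]
    have : ∀ j ∈ Finset.univ.filter (fun j => j ≠ i),
        net.g i j * (net.output (x t j) - net.output (x t i)) =
          net.g i j * (net.output (w t j) - net.output (w t i)) := by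
      intro j hj
      by_cases hjS : j ∈ S
      · simp [hw, hi, hjS]
      · rw [hS i hi j (Finset.mem_filter.1 hj).2 hjS, zero_mul, zero_mul]
    rw [Finset.sum_congr rfl this]
    simp [hw, hi]
  have hwd : ∀ s, 0 ≤ s → HasDerivWithinAt w (w' s) (Set.Ici s) s := by
    intro s hs
    rw [hasDerivWithinAt_pi]
    intro j
    by_cases hj : j ∈ S
    · obtain ⟨X, hX, hXd⟩ := hx.exists_hasDerivAt (hu j hj)
      simp only [hw, hw', hj, if_true]
      rw [← hvel s j hj]
      exact (hXd s hs).hasDerivWithinAt.congr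
        (fun τ hτ => (hX τ (hs.trans hτ)).symm) (hX s hs).symm
    · simp only [hw, hw', hj, if_false]
      exact hasDerivWithinAt_const s _ _
  have hwc : ContinuousOn w (Set.Icc 0 t) := by
    refine continuousOn_pi.2 fun j => ?_
    by_cases hj : j ∈ S
    · simp only [hw, hj, if_true]
      exact (continuous_apply j).comp_continuousOn (hx.1.mono Set.Icc_subset_Ici_self)
    · simp only [hw, hj, if_false]
      exact continuousOn_const
  have h := eq_zero_of_abs_deriv_le_mul_abs_self_of_eq_zero_right (K := ‖V‖) hwc
    (fun s hs => hwd s hs.1)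
    (by ext j k; by_cases hj : j ∈ S <;> simp [hw, hj, hx0])
    (fun s _ => by
      refine le_trans ?_ (V.le_opNorm (w s))
      refine (pi_norm_le_iff_of_nonneg (norm_nonneg _)).2 fun j => ?_
      by_cases hj : j ∈ S
      · simpa [hw', hj] using norm_le_pi_norm (V (w s)) j
      · simp [hw', hj]) t ⟨ht, le_rfl⟩
  have := congrFun h i
  simpa [hw, hi] using this

theorem propagationStable_of_frequencyBound (hα : 0 < net.α) (hs : net.SyncManifoldAsympStable)
    (hfreq : ∀ ω : ℝ, (ω * Complex.I : ℂ) ∉ spectrum ℂ net.complexA → net.FrequencyBound ω) :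
    net.PropagationStable := by
  refine ⟨hs, fun s w _ x ⟨hx0, hx⟩ V1 VC VB hcut T hT b hb => ?_⟩
  by_contra! hlt
  set E := net.energy x T with hE
  have hE0 : ∀ i, 0 ≤ E i := net.energy_nonneg x hT.le
  have hsup0 : 0 ≤ ⨆ c : VC, E c := Real.iSup_nonneg fun c => hE0 c
  have hsup : ∀ c ∈ VC, E c ≤ ⨆ c : VC, E c := fun c hc =>
    le_ciSup (f := fun c : VC => E c) (Set.finite_range _).bddAbove ⟨c, hc⟩
  obtain ⟨m, hmB, hm⟩ := VB.exists_max_image E ⟨b, hb⟩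
  have hmlt : (⨆ c : VC, E c) < E m := hlt.trans_le (hm b hb)
  set S := VB.filter fun i => E i = E m with hS
  have hu : ∀ i ∈ S, ∀ t, (Pi.single s (w t) : Fin N → ℝ) i = 0 := by
    intro i hi t
    have hiB : i ∈ VB := (Finset.mem_filter.1 hi).1
    have his : i ≠ s := by
      rintro rfl
      rcases Finset.mem_union.1 hcut.source_mem with h | h
      · exact Finset.disjoint_left.1 hcut.disjoint_V1_VB h hiB
      · exact Finset.disjoint_left.1 hcut.disjoint_VB_VC hiB h
    simp [his]
  -- Were there an edge into `i ∈ S` from `j ∉ S`, the weighted mean of the in-neighbours' energies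
  -- would be strictly below `E m = E i`, against the local energy inequality.
  have hclosed : ∀ i ∈ S, ∀ j, j ≠ i → j ∉ S → net.g i j = 0 := by
    intro i hi j hji hjS
    by_contra hg
    obtain ⟨hiB, hiE⟩ := Finset.mem_filter.1 hi
    have hgpos : 0 < net.g i j := lt_of_le_of_ne (net.g_nonneg i j) (Ne.symm hg)
    have hcase : ∀ l, 0 < net.g i l → l ∈ VB ∨ l ∈ VC := by
      intro l hl
      have : l ∈ V1 ∪ VC ∪ VB := by rw [hcut.cover]; exact Finset.mem_univ l
      simp only [Finset.mem_union] at this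
      rcases this with (h | h) | h
      · exact absurd hl (hcut.no_edge l h i hiB)
      · exact Or.inr h
      · exact Or.inl h
    have hle : ∀ l, net.g i l * E l ≤ net.g i l * E m := by
      intro l
      rcases (net.g_nonneg i l).eq_or_lt with h0 | hl
      · simp [← h0]
      refine mul_le_mul_of_nonneg_left ?_ hl.le
      rcases hcase l hl with h | h
      · exact hm l h
      · exact (hsup l h).trans hmlt.le
    have hjlt : E j < E m := by
      rcases hcase j hgpos with h | h
      · exact lt_of_le_of_ne (hm j h) fun he => hjS (Finset.mem_filter.2 ⟨h, he⟩)
      · exact (hsup j h).trans_lt hmlt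
    have hjmem : j ∈ Finset.univ.filter (fun j => j ≠ i) := by simpa using hji
    have hiw : 0 < net.inWeight i :=
      hgpos.trans_le (Finset.single_le_sum (fun l _ => net.g_nonneg i l) hjmem)
    have h1 := inWeight_mul_energy_le
      (fun ω hω => (net.frequencyBound_iff_localRequirement hα ω).1 (hfreq ω hω)) hx (hu i hi)
      (by rw [hx0]; rfl) hiw (net.isHurwitz_feedback_gain hα hs hfreq hiw) hT.le
    have h2 : ∑ l with l ≠ i, net.g i l * E l < ∑ l with l ≠ i, net.g i l * E m :=
      Finset.sum_lt_sum (fun l _ => hle l) ⟨j, hjmem, mul_lt_mul_of_pos_left hjlt hgpos⟩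
    rw [← Finset.sum_mul, ← inWeight, ← hiE] at h2
    exact absurd h1 (not_le.2 h2)
  -- Nodes in `S` start at rest, are undisturbed and receive nothing, so the maximal energy is zero,
  -- although it exceeds a nonnegative supremum.
  have hzero : E m = 0 := by
    have : ∀ t ∈ Set.uIcc 0 T, net.output (x t m) ^ 2 = (fun _ => (0 : ℝ)) t := by
      intro t ht
      rw [Set.uIcc_of_le hT.le] at ht
      rw [hx.eq_zero_of_closed hu (fun i _ => by rw [hx0]; rfl) hclosed
        (Finset.mem_filter.2 ⟨hmB, rfl⟩) ht.1]
      simp [output]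
    rw [hE, energy, intervalIntegral.integral_congr this]
    simp
  linarith

end SyncNetwork

theorem theorem3 {N n : ℕ} (net : SyncNetwork N n) (hα : 0 < net.α) :
    (net.SyncManifoldAsympStable →
      (∀ ω : ℝ, (ω * Complex.I : ℂ) ∉ spectrum ℂ net.complexA → net.FrequencyBound ω) →
        net.PropagationStable) ∧
    (∀ ω : ℝ, (ω * Complex.I : ℂ) ∉ spectrum ℂ net.complexA →
      (net.FrequencyBound ω ↔ net.LocalRequirement ω)) :=
  ⟨SyncNetwork.propagationStable_of_frequencyBound hα,
    fun ω _ => net.frequencyBound_iff_localRequirement hα ω⟩
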